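/- Let $\mu(dx)=e^{-x^2}dx$ on $\mathbb R$, let $L=\frac14\partial_x^2-\frac x2\partial_x$, and on functions of $n$ variables let $e^{t\mathcal L}=(e^{tL})^{\otimes n}$ be the Ornstein–Uhlenbeck semigroup, $(e^{t\mathcal L}G)(x)=\mathbb E\,G\big(e^{-t/2}x+\sqrt{1-e^{-t}}\,Y\big)$ with $Y$ having independent centred Gaussian coordinates of variance $\frac12$. Write $f^{\otimes n}(x)=\prod_{i=1}^n f(x_i)$. Call $f\ge 0$ a probability density w.r.t. $\mu$ if $\int f\,d\mu=1$. There is $\lambda_0>0$ such that for every integer $k\ge1$ and every $0<\lambda<\lambda_0$ there is $c>0$ (depending only on $k,\lambda$) with the following property. Let $\theta\in C^\infty(\mathbb R)$ with $0\le\theta\le1$, $\theta(x)=1$ for $|x|\le1$ and $\theta(x)=0$ for $|x|\ge2$; let $C_1,C_2\in\mathbb R$, $\delta>0$ and $0<\kappa<1$. Then there are $C>0$ and $N_0\ge1$, depending only on $k,\lambda,\theta,C_1,C_2,\delta,\kappa$, such that the following holds for every $V\in C^6(\mathbb R)$ for which $u=e^{-V}$ is a probability density w.r.t. $\mu$ and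 $$\sum_{j=1}^6|V^{(j)}(x)|\le C_1(1+x^2)^k,\qquad e^{-V(x)}e^{-x^2}\le C_2e^{-\delta x^2}\quad(x\in\mathbb R),\qquad \int x\,u\,d\mu=0,\qquad \int x^2u\,d\mu=\tfrac12 ,$$ every $N\ge N_0$, and every $c_N\in\mathbb R$ with $|c_N|\le\kappa N^{\lambda/4k}$. Put $t=N^{-1+\lambda}$ and $n=N^2$. There is exactly one $d_N\in\mathbb R$ such that $$v(x)=e^{-V_c(x)},\qquad V_c(x)=V(x)\,\theta\big((x-c_N)N^{-\lambda/4k}\big)+d_N,$$ is a probability density w.r.t. $\mu$. With this $d_N$, the function $xv$ is $\mu$-integrable and $\big|\int x\,v\,d\mu\big|\le Ce^{-cN^c}$ (so every $c_N$ in this range for which $v\,d\mu$ has expectation zero is covered). Moreover: (i) With $F=u^{\otimes n}$ and $F_c=v^{\otimes n}$, the function $F_c-F$ is $\mu^{\otimes n}$-integrable and $$\int|F_c-F|\,d\mu^{\otimes n}\le Ce^{-cN^c}.$$ (ii) $g_t=(1-tL+\frac12t^2L^2)v$ is a probability density w.r.t. $\mu$; with $G_t=g_t^{\otimes n}$ one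 has $e^{t\mathcal L}G_t>0$ everywhere, the integrand below is $\mu^{\otimes n}$-integrable, and $$\int\frac{|e^{t\mathcal L}G_t-F_c|^2}{e^{t\mathcal L}G_t}\,d\mu^{\otimes n}\le CN^2t^{6-\lambda}\le CN^{-4+8\lambda}.$$ -/

import Mathlib

open MeasureTheory
open scoped ContDiff

noncomputable section

/-- The reversible measure `μ(dx) = e^{-x²} dx` on the line (of total mass `√π`, as a density is
normalised through `∫ u dμ = 1`). -/
def ouMeasure : Measure ℝ :=
  volume.withDensity (fun x => ENNReal.ofReal (Real.exp (-x ^ 2)))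

/-- The product measure `μ^{⊗n}` on `ℝⁿ`. -/
def ouMeasurePi (n : ℕ) : Measure (Fin n → ℝ) :=
  Measure.pi (fun _ => ouMeasure)

/-- The Ornstein-Uhlenbeck generator `L = (1/4) d²/dx² - (x/2) d/dx`. -/
def ouGenerator (f : ℝ → ℝ) (x : ℝ) : ℝ :=
  1 / 4 * deriv (deriv f) x - x / 2 * deriv f x

/-- The Ornstein-Uhlenbeck semigroup `e^{tℒ} = (e^{tL})^{⊗n}` on functions of `n` variables:
the transition semigroup of `n` independent OU processes with generator `L`, that is,
`(e^{tℒ} G)(x) = E G(e^{-t/2} x + (1 - e^{-t})^{1/2} Y)` where the coordinates of `Y` are independent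
centred Gaussians of variance `1/2` (with density proportional to `e^{-y²}`). -/
def ouSemigroup {n : ℕ} (t : ℝ) (G : (Fin n → ℝ) → ℝ) (x : Fin n → ℝ) : ℝ :=
  ∫ y, G (fun i => Real.exp (-t / 2) * x i + Real.sqrt (1 - Real.exp (-t)) * y i)
    ∂(Measure.pi (fun _ : Fin n => ProbabilityTheory.gaussianReal 0 (1 / 2)))

/-- The tensor power `f^{⊗n}` of a function on the line. -/
def tensorPow (n : ℕ) (f : ℝ → ℝ) (x : Fin n → ℝ) : ℝ :=
  ∏ i, f (x i)

/-- `f` is a probability density with respect to `μ`. -/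
def IsOUDensity (f : ℝ → ℝ) : Prop :=
  (∀ x, 0 ≤ f x) ∧ Integrable f ouMeasure ∧ ∫ x, f x ∂ouMeasure = 1

/-- The assumptions on the potential `V` of the density `u = e^{-V}`, with
all the constants displayed. The measure `ν = u μ` has Lebesgue density `e^{-V(x)} e^{-x²}`. -/
structure PotentialCond (k : ℕ) (C₁ C₂ δ : ℝ) (V : ℝ → ℝ) : Prop where
  contDiff : ContDiff ℝ 6 V
  deriv_bound : ∀ x, ∑ j ∈ Finset.Icc 1 6, |iteratedDeriv j V x| ≤ C₁ * (1 + x ^ 2) ^ k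
  decay : ∀ x, Real.exp (-V x) * Real.exp (-x ^ 2) ≤ C₂ * Real.exp (-δ * x ^ 2)
  density : IsOUDensity (fun x => Real.exp (-V x))
  mean : ∫ x, x * Real.exp (-V x) ∂ouMeasure = 0
  variance : ∫ x, x ^ 2 * Real.exp (-V x) ∂ouMeasure = 1 / 2

/-- A smooth cutoff function, equal to `1` on `[-1,1]` and to `0` outside `(-2,2)`. -/
structure IsSmoothCutoff (θ : ℝ → ℝ) : Prop where
  contDiff : ContDiff ℝ ∞ θ
  nonneg : ∀ x, 0 ≤ θ x
  le_one : ∀ x, θ x ≤ 1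
  eq_one : ∀ x, |x| ≤ 1 → θ x = 1
  eq_zero : ∀ x, 2 ≤ |x| → θ x = 0

/-- The cutoff density `v = e^{-V_c}`, `V_c(x) = V(x) θ((x - a)/R) + d`. -/
def cutoffDensity (V θ : ℝ → ℝ) (R a d : ℝ) (x : ℝ) : ℝ :=
  Real.exp (-(V x * θ ((x - a) / R) + d))

/-- The approximate backward evolution `g_t = (1 - tL + (1/2) t² L²) v`. -/
def backwardDensity (t : ℝ) (v : ℝ → ℝ) (x : ℝ) : ℝ :=
  v x - t * ouGenerator v x + 1 / 2 * t ^ 2 * ouGenerator (ouGenerator v) x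

end

/-! ### The reference measure and the Gaussian measure -/

/-! Everything reduces to one variable. Write R = N^{λ/4k} and v = e^W.

Tails. On |x| ≤ (1-κ)R the cutoff equals 1, so before normalisation v and u agree there. Elsewhere
both are dominated by a Gaussian. The (1+x²)-weighted L¹ distance of v and u is therefore
O(e^{-ηR²}) (`exists_cutoffDensity_bounds`). This controls the mean of v, since u is centred, and
after telescoping over the n = N² coordinates also the L¹ distance of the products. The factor N² is
only a power of R, so the Gaussian factor absorbs it.

Backward evolution. Set φ(s) = e^{sL}(1 - sL + s²L²/2)v. Then φ(0) = v, and all low-order terms of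
φ' cancel, leaving φ'(s) = (s²/2) e^{sL}L³v. Hence e^{tL}g_t - v is of order t³
(`abs_ouSemigroupOne_backwardDensity_sub_le`). Two facts make this error relative to v. First, L^j
e^W is e^W times a polynomially bounded factor (`exists_ouGenerator_exp_bounds`). Secondly, W is
constant for |x| > 3R and tR^{8k} = N^{-1+3λ} is small, so W changes by at most 1+|y| along the flow
up to time t (`abs_sub_le_of_abs_deriv_le`). Thus e^{sL} distorts e^W only by constants. This yields
g_t ≥ v/2, e^{tL}g_t ≥ const·v, and a one-dimensional χ² distance O(t⁶).

Tensorisation. The χ² distance of n-fold products is (1+χ²)^n - 1, which is at most 2nχ² once nχ² ≤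
1. Here nχ² = O(N²t⁶) = O(N^{-4+6λ}).

All constants must be uniform in V. Bounds on V itself are needed because derivatives may fall on
the cutoff; they come from pinning V(0) through the decay and variance conditions. -/

theorem integral_ouMeasure (f : ℝ → ℝ) :
    ∫ x, f x ∂ouMeasure = ∫ x, f x * Real.exp (-x ^ 2) := by
  unfold ouMeasure
  rw [integral_withDensity_eq_integral_toReal_smul (by fun_prop) (by simp)]
  refine integral_congr_ae (Filter.Eventually.of_forall fun x => ?_)
  simp [ENNReal.toReal_ofReal (Real.exp_pos _).le, mul_comm]

theorem integrable_ouMeasure_iff {f : ℝ → ℝ} :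
    Integrable f ouMeasure ↔ Integrable (fun x => f x * Real.exp (-x ^ 2)) := by
  unfold ouMeasure
  rw [integrable_withDensity_iff (by fun_prop) (by simp)]
  simp [ENNReal.toReal_ofReal (Real.exp_pos _).le]

theorem ouMeasure_eq_smul_gaussianReal :
    ouMeasure = ENNReal.ofReal (√Real.pi) • ProbabilityTheory.gaussianReal 0 (1 / 2) := by
  rw [ProbabilityTheory.gaussianReal_of_var_ne_zero _ (by norm_num), ouMeasure,
    ← withDensity_smul' _ _ ENNReal.ofReal_ne_top]
  congr 1
  ext x
  simp only [Pi.smul_apply, smul_eq_mul, ProbabilityTheory.gaussianPDF]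
  rw [← ENNReal.ofReal_mul (Real.sqrt_nonneg _), ProbabilityTheory.gaussianPDFReal]
  have h : √Real.pi ≠ 0 := (Real.sqrt_pos.2 Real.pi_pos).ne'
  push_cast
  congr 1
  rw [show 2 * Real.pi * (1 / 2) = Real.pi by ring, show 2 * (1 / 2 : ℝ) = 1 by norm_num]
  field_simp
  simp

theorem integral_ouMeasure_eq_gaussianReal (f : ℝ → ℝ) :
    ∫ x, f x ∂ouMeasure
      = √Real.pi * ∫ x, f x ∂(ProbabilityTheory.gaussianReal 0 (1 / 2)) := by
  rw [ouMeasure_eq_smul_gaussianReal, integral_smul_measure,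
    ENNReal.toReal_ofReal (Real.sqrt_nonneg _), smul_eq_mul]

theorem integrable_ouMeasure_iff_gaussianReal {f : ℝ → ℝ} :
    Integrable f ouMeasure ↔ Integrable f (ProbabilityTheory.gaussianReal 0 (1 / 2)) := by
  rw [ouMeasure_eq_smul_gaussianReal]
  exact integrable_smul_measure (by simp [Real.pi_pos]) ENNReal.ofReal_ne_top

instance isFiniteMeasure_ouMeasure : IsFiniteMeasure ouMeasure := by
  rw [ouMeasure_eq_smul_gaussianReal]
  exact ⟨by simp⟩

theorem one_add_sq_pow_le_exp {b : ℝ} (hb : 0 < b) (m : ℕ) :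
    ∃ K : ℝ, 0 < K ∧ ∀ x : ℝ, (1 + x ^ 2) ^ m ≤ K * Real.exp (b * x ^ 2) := by
  refine ⟨m.factorial / b ^ m * Real.exp b, by positivity, fun x => ?_⟩
  have h := Real.pow_div_factorial_le_exp (b * (1 + x ^ 2)) (by positivity) m
  rw [mul_pow, div_le_iff₀ (by positivity)] at h
  have : Real.exp (b * (1 + x ^ 2)) = Real.exp b * Real.exp (b * x ^ 2) := by
    rw [← Real.exp_add]; ring_nf
  rw [this] at h
  have hbm : 0 < b ^ m := by positivity
  calc (1 + x ^ 2) ^ m = (b ^ m * (1 + x ^ 2) ^ m) / b ^ m := by field_simp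
    _ ≤ (Real.exp b * Real.exp (b * x ^ 2) * m.factorial) / b ^ m := by gcongr
    _ = _ := by ring

theorem integrable_one_add_sq_pow_mul_exp {b : ℝ} (hb : 0 < b) (m : ℕ) :
    Integrable (fun x : ℝ => (1 + x ^ 2) ^ m * Real.exp (-b * x ^ 2)) := by
  obtain ⟨K, hK, h⟩ := one_add_sq_pow_le_exp (half_pos hb) m
  refine ((integrable_exp_neg_mul_sq (half_pos hb)).const_mul K).mono'
    (by fun_prop) (Filter.Eventually.of_forall fun x => ?_)
  rw [Real.norm_of_nonneg (by positivity)]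
  calc (1 + x ^ 2) ^ m * Real.exp (-b * x ^ 2)
      ≤ K * Real.exp (b / 2 * x ^ 2) * Real.exp (-b * x ^ 2) := by gcongr; exact h x
    _ = _ := by rw [mul_assoc, ← Real.exp_add]; ring_nf

theorem integrable_one_add_sq_pow_mul_exp_abs (m : ℕ) :
    Integrable (fun y : ℝ => (1 + y ^ 2) ^ m * Real.exp |y|)
      (ProbabilityTheory.gaussianReal 0 (1 / 2)) := by
  rw [← integrable_ouMeasure_iff_gaussianReal, integrable_ouMeasure_iff]
  refine ((integrable_one_add_sq_pow_mul_exp (b := 1 / 2) (by norm_num) m).const_mul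
    (Real.exp 1)).mono' (by fun_prop) (Filter.Eventually.of_forall fun x => ?_)
  rw [Real.norm_of_nonneg (by positivity), mul_assoc, ← Real.exp_add, mul_left_comm,
    ← Real.exp_add]
  refine mul_le_mul_of_nonneg_left (Real.exp_le_exp.2 ?_) (by positivity)
  nlinarith [sq_nonneg (|x| - 1), sq_abs x]

theorem integrable_gaussianReal_of_le {f : ℝ → ℝ} {K : ℝ} (hf : Continuous f) (m : ℕ)
    (h : ∀ y, |f y| ≤ K * ((1 + y ^ 2) ^ m * Real.exp |y|)) :
    Integrable f (ProbabilityTheory.gaussianReal 0 (1 / 2)) :=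
  ((integrable_one_add_sq_pow_mul_exp_abs m).const_mul K).mono' hf.aestronglyMeasurable
    (Filter.Eventually.of_forall h)

/-! ### Functions with weighted bounds on their derivatives -/

/-- `f` is `r` times differentiable with continuous derivatives, all of them bounded by `B * w`. -/
def DerivLE : ℕ → ℝ → (ℝ → ℝ) → (ℝ → ℝ) → Prop
  | 0, B, w, f => Continuous f ∧ ∀ x, |f x| ≤ B * w x
  | r + 1, B, w, f => Differentiable ℝ f ∧ (∀ x, |f x| ≤ B * w x) ∧ DerivLE r B w (deriv f)

namespace DerivLE

variable {r : ℕ} {B B' : ℝ} {w w' f g : ℝ → ℝ}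

theorem bound (h : DerivLE r B w f) (x : ℝ) : |f x| ≤ B * w x := by
  cases r with
  | zero => exact h.2 x
  | succ r => exact h.2.1 x

theorem continuous (h : DerivLE r B w f) : Continuous f := by
  cases r with
  | zero => exact h.1
  | succ r => exact h.1.continuous

theorem deriv (h : DerivLE (r + 1) B w f) : DerivLE r B w (_root_.deriv f) := h.2.2

theorem mono_weight (h : DerivLE r B w f) (hw : ∀ x, B * w x ≤ B' * w' x) : DerivLE r B' w' f := by
  induction r generalizing f with
  | zero => exact ⟨h.1, fun x => (h.2 x).trans (hw x)⟩
  | succ r ih => exact ⟨h.1, fun x => (h.2.1 x).trans (hw x), ih h.2.2⟩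

theorem of_succ (h : DerivLE (r + 1) B w f) : DerivLE r B w f := by
  induction r generalizing f with
  | zero => exact ⟨h.1.continuous, h.2.1⟩
  | succ r ih => exact ⟨h.1, h.2.1, ih h.2.2⟩

theorem of_le {s : ℕ} (h : DerivLE r B w f) (hs : s ≤ r) : DerivLE s B w f := by
  induction hs with
  | refl => exact h
  | step _ ih => exact ih h.of_succ

theorem add (hf : DerivLE r B w f) (hg : DerivLE r B' w g) :
    DerivLE r (B + B') w (fun x => f x + g x) := by
  have key : ∀ {f g : ℝ → ℝ}, (∀ x, |f x| ≤ B * w x) → (∀ x, |g x| ≤ B' * w x) →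
      ∀ x, |f x + g x| ≤ (B + B') * w x := fun hf hg x => by
    rw [add_mul]; exact (abs_add_le _ _).trans (add_le_add (hf x) (hg x))
  induction r generalizing f g with
  | zero => exact ⟨hf.1.add hg.1, key hf.2 hg.2⟩
  | succ r ih =>
    refine ⟨hf.1.add hg.1, key hf.2.1 hg.2.1, ?_⟩
    have : _root_.deriv (fun x => f x + g x)
        = fun x => _root_.deriv f x + _root_.deriv g x := by
      ext x; exact deriv_fun_add (hf.1 x) (hg.1 x)
    rw [this]
    exact ih hf.2.2 hg.2.2

theorem const_mul (c : ℝ) (hf : DerivLE r B w f) :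
    DerivLE r (|c| * B) w (fun x => c * f x) := by
  have key : ∀ {f : ℝ → ℝ}, (∀ x, |f x| ≤ B * w x) → ∀ x, |c * f x| ≤ |c| * B * w x :=
    fun hf x => by rw [abs_mul, mul_assoc]; gcongr; exact hf x
  induction r generalizing f with
  | zero => exact ⟨hf.1.const_mul c, key hf.2⟩
  | succ r ih =>
    refine ⟨hf.1.const_mul c, key hf.2.1, ?_⟩
    have : _root_.deriv (fun x => c * f x) = fun x => c * _root_.deriv f x := by
      ext x; exact deriv_const_mul c (hf.1 x)
    rw [this]
    exact ih hf.2.2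

theorem neg (hf : DerivLE r B w f) : DerivLE r B w (fun x => -f x) := by
  have := hf.const_mul (-1)
  simpa using this

/-- Each application of the Leibniz rule doubles the number of terms, whence the factor 2^r. -/
theorem mul (hf : DerivLE r B w f) (hg : DerivLE r B' w' g) :
    DerivLE r (2 ^ r * (B * B')) (fun x => w x * w' x) (fun x => f x * g x) := by
  have key : ∀ x, |f x * g x| ≤ (B * B') * (w x * w' x) := fun x => by
    rw [abs_mul, mul_mul_mul_comm]
    exact mul_le_mul (hf.bound x) (hg.bound x) (abs_nonneg _) ((abs_nonneg _).trans (hf.bound x))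
  have pos : ∀ x, 0 ≤ (B * B') * (w x * w' x) := fun x => (abs_nonneg _).trans (key x)
  induction r generalizing f g with
  | zero => exact ⟨hf.1.mul hg.1, by simpa using key⟩
  | succ r ih =>
    refine ⟨hf.1.mul hg.1, fun x => (key x).trans ?_, ?_⟩
    · have h2 : (1 : ℝ) ≤ 2 ^ (r + 1) := one_le_pow₀ one_le_two
      exact (le_mul_of_one_le_left (pos x) h2).trans_eq (by ring)
    have : _root_.deriv (fun x => f x * g x)
        = fun x => _root_.deriv f x * g x + f x * _root_.deriv g x := by
      ext x; exact deriv_fun_mul (hf.1 x) (hg.1 x)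
    rw [this]
    have key2 : ∀ {f g : ℝ → ℝ}, DerivLE r B w f → DerivLE r B' w' g →
        ∀ x, |f x * g x| ≤ (B * B') * (w x * w' x) := fun {f g} hf hg x => by
      rw [abs_mul, mul_mul_mul_comm]
      exact mul_le_mul (hf.bound x) (hg.bound x) (abs_nonneg _)
        ((abs_nonneg _).trans (hf.bound x))
    have h := (ih hf.2.2 hg.of_succ (key2 hf.2.2 hg.of_succ)).add
      (ih hf.of_succ hg.2.2 (key2 hf.of_succ hg.2.2))
    refine h.mono_weight fun x => le_of_eq ?_
    ring

theorem const (c : ℝ) : DerivLE r |c| (fun _ => 1) (fun _ => c) := by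
  induction r generalizing c with
  | zero => exact ⟨continuous_const, by simp⟩
  | succ r ih =>
    refine ⟨differentiable_const c, by simp, ?_⟩
    have : _root_.deriv (fun _ : ℝ => c) = fun _ => (0 : ℝ) := by ext x; simp
    rw [this]
    exact (ih 0).mono_weight (by simp)

theorem id (hw : ∀ x, 1 ≤ w x) (hw' : ∀ x, |x| ≤ w x) : DerivLE r 1 w (fun x => x) := by
  cases r with
  | zero => exact ⟨continuous_id, by simpa using hw'⟩
  | succ r =>
    refine ⟨differentiable_id, by simpa using hw', ?_⟩
    have : _root_.deriv (fun x : ℝ => x) = fun _ => (1 : ℝ) := by ext x; simp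
    rw [this]
    exact (const 1).mono_weight (by simpa using hw)

/-- Every derivative gains a factor 1/R ≤ 1, so the rescaled cutoff obeys bounds independent of R
and a. -/
theorem comp_affine {a R : ℝ} (hR : 1 ≤ R) (hB : 0 ≤ B) (hf : DerivLE r B (fun _ => 1) f) :
    DerivLE r B (fun _ => 1) (fun x => f ((x - a) / R)) := by
  induction r generalizing f with
  | zero => exact ⟨hf.1.comp (by fun_prop), fun x => hf.2 _⟩
  | succ r ih =>
    refine ⟨hf.1.comp (by fun_prop), fun x => hf.2.1 _, ?_⟩
    have : _root_.deriv (fun x => f ((x - a) / R))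
        = fun x => R⁻¹ * _root_.deriv f ((x - a) / R) := by
      ext x
      have h1 : HasDerivAt (fun x => (x - a) / R) (1 / R) x :=
        ((hasDerivAt_id x).sub_const a).div_const R
      have := (hf.1 ((x - a) / R)).hasDerivAt.comp x h1
      rw [Function.comp_def] at this
      rw [this.deriv]; ring
    rw [this]
    refine ((ih hf.2.2).const_mul R⁻¹).mono_weight fun x => ?_
    have : |R⁻¹| ≤ 1 := by
      rw [abs_of_nonneg (by positivity)]; exact inv_le_one_of_one_le₀ hR
    nlinarith

theorem contDiff (h : DerivLE r B w f) : ContDiff ℝ r f := by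
  induction r generalizing f with
  | zero => exact contDiff_zero.2 h.1
  | succ r ih =>
    push_cast
    exact (contDiff_succ_iff_deriv).2 ⟨h.1, by simp, ih h.2.2⟩

theorem of_iteratedDeriv (hf : ContDiff ℝ r f)
    (h : ∀ i ≤ r, ∀ x, |iteratedDeriv i f x| ≤ B * w x) : DerivLE r B w f := by
  induction r generalizing f with
  | zero => exact ⟨hf.continuous, by simpa using h 0 le_rfl⟩
  | succ r ih =>
    push_cast at hf
    obtain ⟨h1, -, h2⟩ := (contDiff_succ_iff_deriv).1 hf
    refine ⟨h1, by simpa using h 0 (by omega), ih h2 fun i hi x => ?_⟩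
    have := h (i + 1) (by omega) x
    rwa [iteratedDeriv_succ'] at this

theorem exists_of_hasCompactSupport (hf : ContDiff ℝ r f) (hc : HasCompactSupport f) :
    ∃ M : ℝ, 0 ≤ M ∧ DerivLE r M (fun _ => 1) f := by
  induction r generalizing f with
  | zero =>
    obtain ⟨C, hC⟩ := hf.continuous.bounded_above_of_compact_support hc
    exact ⟨C, (norm_nonneg _).trans (hC 0), hf.continuous, by simpa using hC⟩
  | succ r ih =>
    push_cast at hf
    obtain ⟨h1, -, h2⟩ := (contDiff_succ_iff_deriv).1 hf
    obtain ⟨C, hC⟩ := hf.continuous.bounded_above_of_compact_support hc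
    obtain ⟨M, hM, hM'⟩ := ih h2 hc.deriv
    refine ⟨max C M, le_max_of_le_right hM, h1, fun x => ?_, hM'.mono_weight fun x => ?_⟩
    · simpa using Or.inl (hC x)
    · simp

end DerivLE

/-! ### The generator -/

/-- The generator conjugated with `e^W`, i.e. `e^{-W} L (e^W A)`. -/
noncomputable def conjGenerator (W A : ℝ → ℝ) (x : ℝ) : ℝ :=
  1 / 4 * deriv (deriv A) x + 1 / 2 * (deriv W x * deriv A x)
    + 1 / 4 * (deriv W x * (deriv W x * A x)) + 1 / 4 * (deriv (deriv W) x * A x)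
    + (-(1 / 2)) * (x * deriv A x) + (-(1 / 2)) * (x * (deriv W x * A x))

theorem hasDerivAt_of_contDiff_two {f : ℝ → ℝ} (hf : ContDiff ℝ 2 f) (x : ℝ) :
    HasDerivAt f (deriv f x) x ∧ HasDerivAt (deriv f) (deriv (deriv f) x) x := by
  have h := (contDiff_succ_iff_deriv (n := 1)).1 hf
  exact ⟨(h.1 x).hasDerivAt, ((h.2.2.differentiable (by norm_num)) x).hasDerivAt⟩

theorem ouGenerator_exp_mul {W A : ℝ → ℝ} (hW : ContDiff ℝ 2 W) (hA : ContDiff ℝ 2 A) :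
    ouGenerator (fun x => Real.exp (W x) * A x)
      = fun x => Real.exp (W x) * conjGenerator W A x := by
  have h1 : deriv (fun x => Real.exp (W x) * A x)
      = fun x => Real.exp (W x) * (deriv A x + deriv W x * A x) := by
    ext x
    have := ((hasDerivAt_of_contDiff_two hW x).1.exp).mul (hasDerivAt_of_contDiff_two hA x).1
    rw [show (fun x => Real.exp (W x) * A x) = (fun x => Real.exp (W x)) * A from rfl, this.deriv]
    ring
  have h2 : ∀ x, deriv (fun x => Real.exp (W x) * (deriv A x + deriv W x * A x)) x
      = Real.exp (W x) * (deriv W x * (deriv A x + deriv W x * A x)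
        + (deriv (deriv A) x + (deriv (deriv W) x * A x + deriv W x * deriv A x))) := by
    intro x
    obtain ⟨hW1, hW2⟩ := hasDerivAt_of_contDiff_two hW x
    obtain ⟨hA1, hA2⟩ := hasDerivAt_of_contDiff_two hA x
    have := hW1.exp.mul (hA2.add (hW2.mul hA1))
    rw [show (fun x => Real.exp (W x) * (deriv A x + deriv W x * A x))
      = (fun x => Real.exp (W x)) * (deriv A + deriv W * A) from rfl, this.deriv]
    simp only [Pi.add_apply, Pi.mul_apply]
    ring
  ext x
  rw [ouGenerator, h1, h2, conjGenerator]
  ring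

/-- Each of the six terms of `conjGenerator` carries at most two factors among x, W', W'', each
bounded by q, so one application costs q². The restriction r ≤ 4 reflects that W'' has only four
controlled derivatives. -/
theorem exists_derivLE_conjGenerator {B B' : ℝ} (hB : 0 ≤ B) (hB' : 0 ≤ B') {r : ℕ} (hr : r ≤ 4)
    (m : ℕ) :
    ∃ K : ℝ, 0 ≤ K ∧ ∀ W A q : ℝ → ℝ, (∀ x, 1 ≤ q x) → (∀ x, |x| ≤ q x) →
      DerivLE 5 B q (deriv W) → DerivLE (r + 2) B' (fun x => q x ^ m) A →
      DerivLE r K (fun x => q x ^ (m + 2)) (conjGenerator W A) := by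
  refine ⟨|1 / 4| * B' + |1 / 2| * (2 ^ r * (B * B')) + |1 / 4| * (2 ^ r * (B * (2 ^ r * (B * B'))))
    + |1 / 4| * (2 ^ r * (B * B')) + |-(1 / 2)| * (2 ^ r * (1 * B'))
    + |-(1 / 2)| * (2 ^ r * (1 * (2 ^ r * (B * B')))), by positivity, ?_⟩
  intro W A q hq hxq hW hA
  have hW1 : DerivLE r B q (deriv W) := hW.of_le (by omega)
  have hW2 : DerivLE r B q (deriv (deriv W)) := hW.deriv.of_le (by omega)
  have hA0 := hA.of_succ.of_succ
  have hA1 := hA.deriv.of_succ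
  have hA2 := hA.deriv.deriv
  have hx : DerivLE r 1 q (fun x => x) := DerivLE.id hq hxq
  have hqm : ∀ x, q x ^ m ≤ q x ^ (m + 2) := fun x => pow_le_pow_right₀ (hq x) (by omega)
  have hqm1 : ∀ x, q x * q x ^ m ≤ q x ^ (m + 2) := fun x => by
    rw [← pow_succ']; exact pow_le_pow_right₀ (hq x) (by omega)
  have hqm2 : ∀ x, q x * (q x * q x ^ m) ≤ q x ^ (m + 2) := fun x => by
    rw [← pow_succ', ← pow_succ']
  have T1 := (hA2.mono_weight (w' := fun x => q x ^ (m + 2)) (B' := B')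
    fun x => mul_le_mul_of_nonneg_left (hqm x) hB').const_mul (1 / 4)
  have T2 := ((hW1.mul hA1).mono_weight (w' := fun x => q x ^ (m + 2)) (B' := 2 ^ r * (B * B'))
    fun x => mul_le_mul_of_nonneg_left (hqm1 x) (by positivity)).const_mul (1 / 2)
  have T3 := ((hW1.mul (hW1.mul hA0)).mono_weight (w' := fun x => q x ^ (m + 2))
    (B' := 2 ^ r * (B * (2 ^ r * (B * B'))))
    fun x => mul_le_mul_of_nonneg_left (hqm2 x) (by positivity)).const_mul (1 / 4)
  have T4 := ((hW2.mul hA0).mono_weight (w' := fun x => q x ^ (m + 2)) (B' := 2 ^ r * (B * B'))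
    fun x => mul_le_mul_of_nonneg_left (hqm1 x) (by positivity)).const_mul (1 / 4)
  have T5 := ((hx.mul hA1).mono_weight (w' := fun x => q x ^ (m + 2)) (B' := 2 ^ r * (1 * B'))
    fun x => mul_le_mul_of_nonneg_left (hqm1 x) (by positivity)).const_mul (-(1 / 2))
  have T6 := ((hx.mul (hW1.mul hA0)).mono_weight (w' := fun x => q x ^ (m + 2))
    (B' := 2 ^ r * (1 * (2 ^ r * (B * B'))))
    fun x => mul_le_mul_of_nonneg_left (hqm2 x) (by positivity)).const_mul (-(1 / 2))
  exact ((((T1.add T2).add T3).add T4).add T5).add T6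

theorem exists_ouGenerator_exp_bounds {B : ℝ} (hB : 0 ≤ B) :
    ∃ K : ℝ, 0 ≤ K ∧ ∀ W q : ℝ → ℝ, ContDiff ℝ 2 W → (∀ x, 1 ≤ q x) → (∀ x, |x| ≤ q x) →
      DerivLE 5 B q (deriv W) → ∀ x,
      |ouGenerator (fun x => Real.exp (W x)) x| ≤ K * q x ^ 2 * Real.exp (W x) ∧
      |ouGenerator (ouGenerator (fun x => Real.exp (W x))) x| ≤ K * q x ^ 4 * Real.exp (W x) ∧
      |ouGenerator (ouGenerator (ouGenerator (fun x => Real.exp (W x)))) x|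
        ≤ K * q x ^ 6 * Real.exp (W x) := by
  -- Starting from A = 1, the generator is applied three times. Two derivatives are lost each time
  -- (4, 2, 0 remain) and the weight rises to q², q⁴, q⁶.
  obtain ⟨K₁, hK₁, h₁⟩ := exists_derivLE_conjGenerator hB (B' := |1|) (by simp) (r := 4) le_rfl 0
  obtain ⟨K₂, hK₂, h₂⟩ := exists_derivLE_conjGenerator hB hK₁ (r := 2) (by omega) 2
  obtain ⟨K₃, hK₃, h₃⟩ := exists_derivLE_conjGenerator hB hK₂ (r := 0) (by omega) 4
  refine ⟨K₁ + K₂ + K₃, by positivity, fun W q hW hq hxq hdW x => ?_⟩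
  have d₁ := h₁ W (fun _ => 1) q hq hxq hdW (by simpa using DerivLE.const 1)
  have d₂ := h₂ W _ q hq hxq hdW d₁
  have d₃ := h₃ W _ q hq hxq hdW d₂
  have e₁ : ouGenerator (fun x => Real.exp (W x))
      = fun x => Real.exp (W x) * conjGenerator W (fun _ => 1) x := by
    simpa using ouGenerator_exp_mul hW (contDiff_const (c := (1 : ℝ)))
  have e₂ := ouGenerator_exp_mul hW (d₁.contDiff.of_le (by norm_num))
  have e₃ := ouGenerator_exp_mul hW d₂.contDiff
  rw [e₁, e₂, e₃]
  have hq0 : 0 ≤ q x := zero_le_one.trans (hq x)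
  have key : ∀ {a K : ℝ} {m : ℕ}, |a| ≤ K * q x ^ m → K ≤ K₁ + K₂ + K₃ →
      |Real.exp (W x) * a| ≤ (K₁ + K₂ + K₃) * q x ^ m * Real.exp (W x) := by
    intro a K m ha hK
    rw [abs_mul, Real.abs_exp, mul_comm]
    gcongr
    exact ha.trans (by gcongr)
  exact ⟨key (d₁.bound x) (by linarith), key (d₂.bound x) (by linarith),
    key (d₃.bound x) (by linarith)⟩

theorem ouGenerator_eq_zero_of_eq_const {f : ℝ → ℝ} {U : Set ℝ} (hU : IsOpen U) {c : ℝ}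
    (h : ∀ x ∈ U, f x = c) {x : ℝ} (hx : x ∈ U) : ouGenerator f x = 0 := by
  have h1 : f =ᶠ[nhds x] fun _ => c := Filter.mem_of_superset (hU.mem_nhds hx) h
  have h2 := h1.deriv
  have h3 := h2.deriv
  rw [ouGenerator, h3.eq_of_nhds, h2.eq_of_nhds]
  simp

theorem contDiff_ouGenerator {f : ℝ → ℝ} {n : ℕ} (hf : ContDiff ℝ (n + 2 : ℕ) f) :
    ContDiff ℝ n (ouGenerator f) := by
  have h1 : ContDiff ℝ (n + 1 : ℕ) (deriv f) := by
    have : ((n + 2 : ℕ) : WithTop ℕ∞) = (n + 1 : ℕ) + 1 := by push_cast; ring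
    rw [this] at hf
    exact (contDiff_succ_iff_deriv.1 hf).2.2
  have h2 : ContDiff ℝ n (deriv (deriv f)) := by
    rw [Nat.cast_add_one] at h1
    exact (contDiff_succ_iff_deriv.1 h1).2.2
  have h1' : ContDiff ℝ n (deriv f) := h1.of_le (by exact_mod_cast Nat.le_succ n)
  unfold ouGenerator
  fun_prop

theorem integral_ouGenerator {f : ℝ → ℝ} (hf : ContDiff ℝ 2 f)
    (hc : HasCompactSupport (deriv f)) :
    Integrable (ouGenerator f) ouMeasure ∧ ∫ x, ouGenerator f x ∂ouMeasure = 0 := by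
  have hcont : Continuous (deriv f) :=
    continuous_iff_continuousAt.2 fun x => (hasDerivAt_of_contDiff_two hf x).2.continuousAt
  have hc2 : Continuous (ouGenerator f) :=
    (contDiff_ouGenerator (n := 0) (by exact_mod_cast hf)).continuous
  have hs : HasCompactSupport (fun x => ouGenerator f x * Real.exp (-x ^ 2)) := by
    refine HasCompactSupport.mul_right ?_
    have h := (hc.deriv.mul_left (f := fun _ => 1 / 4)).add (hc.mul_left (f := fun x => -(x / 2)))
    have e : ouGenerator f
        = (fun _ => 1 / 4) * deriv (deriv f) + (fun x => -(x / 2)) * deriv f := by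
      ext x
      simp only [ouGenerator, Pi.add_apply, Pi.mul_apply]
      ring
    rwa [e]
  have i1 : Integrable (fun x => ouGenerator f x * Real.exp (-x ^ 2)) :=
    (hc2.mul (by fun_prop)).integrable_of_hasCompactSupport hs
  refine ⟨integrable_ouMeasure_iff.2 i1, ?_⟩
  rw [integral_ouMeasure]
  -- Divergence form of the generator: (Lf) e^{-x²} is the derivative of f' e^{-x²}/4.
  refine integral_eq_zero_of_hasDerivAt_of_integrable
    (f := fun x => deriv f x * (1 / 4 * Real.exp (-x ^ 2))) (fun x => ?_) i1 ?_
  · have h1 : HasDerivAt (fun x : ℝ => Real.exp (-x ^ 2)) (Real.exp (-x ^ 2) * (-(2 * x))) x := by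
      have := ((hasDerivAt_id x).pow 2).neg.exp
      simpa using this
    have := (hasDerivAt_of_contDiff_two hf x).2.mul (h1.const_mul (1 / 4))
    refine this.congr_deriv ?_
    rw [ouGenerator]; ring
  · exact (hcont.mul (by fun_prop)).integrable_of_hasCompactSupport hc.mul_right

/-! ### The one-dimensional semigroup -/

theorem integral_linear_combination₃ {α : Type*} [MeasurableSpace α] {μ : Measure α}
    {f g h : α → ℝ} (hf : Integrable f μ) (hg : Integrable g μ) (hh : Integrable h μ)
    (a b c : ℝ) : ∫ x, (a * f x + b * g x + c * h x) ∂μ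
      = a * ∫ x, f x ∂μ + b * ∫ x, g x ∂μ + c * ∫ x, h x ∂μ := by
  have h1 : Integrable (fun x => a * f x + b * g x) μ := (hf.const_mul a).add (hg.const_mul b)
  rw [integral_add h1 (hh.const_mul c), integral_add (hf.const_mul a) (hg.const_mul b),
    integral_const_mul, integral_const_mul, integral_const_mul]

/-- The Ornstein-Uhlenbeck semigroup on functions of one variable. -/
noncomputable def ouSemigroupOne (s : ℝ) (f : ℝ → ℝ) (x : ℝ) : ℝ :=
  ∫ y, f (Real.exp (-s / 2) * x + √(1 - Real.exp (-s)) * y)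
    ∂(ProbabilityTheory.gaussianReal 0 (1 / 2))

theorem ouSemigroup_tensorPow (t : ℝ) (n : ℕ) (f : ℝ → ℝ) (x : Fin n → ℝ) :
    ouSemigroup t (tensorPow n f) x = tensorPow n (ouSemigroupOne t f) x := by
  unfold ouSemigroup tensorPow ouSemigroupOne
  exact integral_fintype_prod_eq_prod
    (fun i y => f (Real.exp (-t / 2) * x i + √(1 - Real.exp (-t)) * y))

theorem continuous_ouSemigroupOne_uncurry {f : ℝ → ℝ} {M : ℝ} (hf : Continuous f)
    (hM : ∀ x, |f x| ≤ M) : Continuous (fun p : ℝ × ℝ => ouSemigroupOne p.1 f p.2) := by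
  unfold ouSemigroupOne
  refine continuous_of_dominated (bound := fun _ => M) (fun p => ?_) (fun p => ?_)
    (integrable_const M) (Filter.Eventually.of_forall fun y => ?_)
  · exact (hf.comp (by fun_prop)).aestronglyMeasurable
  · exact Filter.Eventually.of_forall fun y => hM _
  · exact hf.comp (by fun_prop)

theorem integrable_comp_affine_gaussianReal {f : ℝ → ℝ} {M : ℝ} (hf : Continuous f)
    (hM : ∀ x, |f x| ≤ M) (a b : ℝ) :
    Integrable (fun y => f (a + b * y)) (ProbabilityTheory.gaussianReal 0 (1 / 2)) :=
  (integrable_const M).mono' (hf.comp (by fun_prop)).aestronglyMeasurable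
    (Filter.Eventually.of_forall fun y => hM _)

theorem integrable_mul_comp_affine_gaussianReal {f : ℝ → ℝ} {M : ℝ} (hf : Continuous f)
    (hM : ∀ x, |f x| ≤ M) (a b : ℝ) :
    Integrable (fun y => y * f (a + b * y)) (ProbabilityTheory.gaussianReal 0 (1 / 2)) := by
  have hM0 : 0 ≤ M := (abs_nonneg _).trans (hM 0)
  refine integrable_gaussianReal_of_le (K := M) (by fun_prop) 1 fun y => ?_
  rw [abs_mul, pow_one]
  have h1 : |y| ≤ 1 + y ^ 2 := by nlinarith [sq_nonneg (|y| - 1), sq_abs y]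
  have h2 : 1 ≤ Real.exp |y| := Real.one_le_exp (abs_nonneg y)
  calc |y| * |f (a + b * y)| ≤ (1 + y ^ 2) * M := by gcongr; exact hM _
    _ ≤ (1 + y ^ 2) * M * Real.exp |y| := le_mul_of_one_le_right (by positivity) h2
    _ = _ := by ring

/-- Gaussian integration by parts for variance 1/2, from the vanishing integral of (g e^{-y²})'. -/
theorem integral_id_mul_gaussianReal {g g' : ℝ → ℝ} (hg : ∀ y, HasDerivAt g (g' y) y)
    (i : Integrable g (ProbabilityTheory.gaussianReal 0 (1 / 2)))
    (i' : Integrable g' (ProbabilityTheory.gaussianReal 0 (1 / 2)))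
    (iy : Integrable (fun y => y * g y) (ProbabilityTheory.gaussianReal 0 (1 / 2))) :
    ∫ y, y * g y ∂(ProbabilityTheory.gaussianReal 0 (1 / 2))
      = 1 / 2 * ∫ y, g' y ∂(ProbabilityTheory.gaussianReal 0 (1 / 2)) := by
  have hpi : √Real.pi ≠ 0 := (Real.sqrt_pos.2 Real.pi_pos).ne'
  have key : ∫ y, (g' y - 2 * (y * g y)) ∂ouMeasure = 0 := by
    rw [integral_ouMeasure]
    refine integral_eq_zero_of_hasDerivAt_of_integrable
      (f := fun y => g y * Real.exp (-y ^ 2)) (fun y => ?_) ?_ ?_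
    · have h1 : HasDerivAt (fun x : ℝ => Real.exp (-x ^ 2)) (Real.exp (-y ^ 2) * (-(2 * y))) y := by
        have := ((hasDerivAt_id y).pow 2).neg.exp
        simpa using this
      exact ((hg y).mul h1).congr_deriv (by ring)
    · rw [← integrable_ouMeasure_iff, integrable_ouMeasure_iff_gaussianReal]
      exact i'.sub (iy.const_mul 2)
    · rwa [← integrable_ouMeasure_iff, integrable_ouMeasure_iff_gaussianReal]
  rw [integral_ouMeasure_eq_gaussianReal, mul_eq_zero, or_iff_right hpi,
    integral_sub i' (iy.const_mul 2), integral_const_mul] at key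
  linarith

/-- Differentiation under the Gaussian integral produces a term with y f', which integration by
parts turns into f''. With σ² = 1 - e^{-s}, both sides then have the coefficient e^{-s}/4 in front
of the integral of f''. -/
theorem hasDerivAt_ouSemigroupOne {f : ℝ → ℝ} {M : ℝ} (hf : DerivLE 2 M (fun _ => 1) f)
    (x : ℝ) {s : ℝ} (hs : 0 < s) :
    HasDerivAt (fun s => ouSemigroupOne s f x) (ouSemigroupOne s (ouGenerator f) x) s := by
  have hM0 : 0 ≤ M := by have := (abs_nonneg _).trans (hf.bound 0); simpa using this
  have b0 : ∀ x, |f x| ≤ M := fun x => by simpa using hf.bound x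
  have b1 : ∀ x, |deriv f x| ≤ M := fun x => by simpa using hf.deriv.bound x
  have b2 : ∀ x, |deriv (deriv f) x| ≤ M := fun x => by simpa using hf.deriv.deriv.bound x
  have c0 := hf.continuous
  have c1 := hf.deriv.continuous
  have c2 := hf.deriv.deriv.continuous
  have sig : ∀ {r : ℝ}, 0 < r → 0 < 1 - Real.exp (-r) := fun {r} hr => by
    have : Real.exp (-r) < 1 := Real.exp_zero ▸ Real.exp_lt_exp.2 (by linarith)
    linarith
  set F' : ℝ → ℝ → ℝ := fun r y =>
    deriv f (Real.exp (-r / 2) * x + √(1 - Real.exp (-r)) * y)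
      * (-(1 / 2) * Real.exp (-r / 2) * x + Real.exp (-r) / (2 * √(1 - Real.exp (-r))) * y) with hF'
  have hdiff : ∀ y, ∀ r ∈ Set.Ioi (s / 2), HasDerivAt
      (fun r => f (Real.exp (-r / 2) * x + √(1 - Real.exp (-r)) * y)) (F' r y) r := by
    intro y r hr
    have hr0 : 0 < r := lt_trans (by linarith) hr
    have h1 : HasDerivAt (fun r : ℝ => Real.exp (-r / 2)) (Real.exp (-r / 2) * (-1 / 2)) r :=
      ((hasDerivAt_id r).neg.div_const 2).exp
    have h2 : HasDerivAt (fun r : ℝ => 1 - Real.exp (-r)) (-(Real.exp (-r) * (-1))) r :=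
      ((hasDerivAt_id r).neg.exp).const_sub 1
    have h3 := (h1.mul_const x).add ((h2.sqrt (sig hr0).ne').mul_const y)
    have h4 := ((hf.1 (Real.exp (-r / 2) * x + √(1 - Real.exp (-r)) * y)).hasDerivAt).comp r h3
    refine h4.congr_deriv ?_
    simp only [hF']
    ring
  -- The derivative of √(1 - e^{-r}) blows up at r = 0. Restricting to r > s/2 keeps the root above
  -- σ₀ and gives an integrable majorant.
  set σ₀ := √(1 - Real.exp (-(s / 2))) with hσ₀
  have hσ₀pos : 0 < σ₀ := Real.sqrt_pos.2 (sig (by linarith))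
  have hbound : ∀ y, ∀ r ∈ Set.Ioi (s / 2), ‖F' r y‖ ≤ M * (|x| + (2 * σ₀)⁻¹ * |y|) := by
    intro y r hr
    have hr' : s / 2 < r := hr
    have hr0 : 0 < r := lt_trans (by linarith) hr'
    rw [Real.norm_eq_abs, hF', abs_mul]
    have e1 : Real.exp (-r / 2) ≤ 1 := Real.exp_le_one_iff.2 (by linarith)
    have e2 : Real.exp (-r) ≤ 1 := Real.exp_le_one_iff.2 (by linarith)
    have e3 : σ₀ ≤ √(1 - Real.exp (-r)) :=
      Real.sqrt_le_sqrt (by linarith [Real.exp_le_exp.2 (by linarith : -r ≤ -(s / 2))])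
    refine mul_le_mul (b1 _) ((abs_add_le _ _).trans (add_le_add ?_ ?_)) (abs_nonneg _) hM0
    · rw [abs_mul, abs_mul, Real.abs_exp]
      have : |(-(1 / 2) : ℝ)| * Real.exp (-r / 2) ≤ 1 := by
        rw [abs_neg, abs_of_pos (by norm_num)]; linarith
      exact mul_le_of_le_one_left (abs_nonneg _) this
    · rw [abs_mul, abs_of_pos (by have := Real.sqrt_pos.2 (sig hr0); positivity)]
      refine mul_le_mul_of_nonneg_right ?_ (abs_nonneg _)
      rw [div_eq_mul_inv]
      refine (mul_le_of_le_one_left (by positivity) e2).trans ?_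
      gcongr
  have iabs : Integrable (fun y : ℝ => |y|) (ProbabilityTheory.gaussianReal 0 (1 / 2)) := by
    have := integrable_mul_comp_affine_gaussianReal (f := fun _ => 1) continuous_const
      (M := 1) (by simp) 0 0
    simpa using this.abs
  have main := hasDerivAt_integral_of_dominated_loc_of_deriv_le
    (μ := ProbabilityTheory.gaussianReal 0 (1 / 2))
    (F := fun r y => f (Real.exp (-r / 2) * x + √(1 - Real.exp (-r)) * y)) (F' := F')
    (bound := fun y => M * (|x| + (2 * σ₀)⁻¹ * |y|))
    (x₀ := s) (s := Set.Ioi (s / 2)) (Ioi_mem_nhds (by linarith))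
    (Filter.Eventually.of_forall fun r => (c0.comp (by fun_prop)).aestronglyMeasurable)
    (integrable_comp_affine_gaussianReal c0 b0 _ _)
    (by
      refine Continuous.aestronglyMeasurable ?_
      simp only [hF']
      fun_prop)
    (Filter.Eventually.of_forall hbound)
    (((integrable_const _).add (iabs.const_mul _)).const_mul M)
    (Filter.Eventually.of_forall hdiff)
  refine main.2.congr_deriv ?_
  set σ := √(1 - Real.exp (-s)) with hσ
  have hσpos : 0 < σ := Real.sqrt_pos.2 (sig hs)
  have hσ2 : σ ^ 2 = 1 - Real.exp (-s) := Real.sq_sqrt (sig hs).le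
  set a := Real.exp (-s / 2) * x with ha
  have i1 := integrable_comp_affine_gaussianReal c1 b1 a σ
  have i2 := integrable_comp_affine_gaussianReal c2 b2 a σ
  have iy := integrable_mul_comp_affine_gaussianReal c1 b1 a σ
  have ibp := integral_id_mul_gaussianReal (g := fun y => deriv f (a + σ * y))
    (g' := fun y => σ * deriv (deriv f) (a + σ * y)) (fun y => by
      have h1 : HasDerivAt (fun y => a + σ * y) (σ * 1) y :=
        ((hasDerivAt_id y).const_mul σ).const_add a
      have := ((hf.deriv.1 (a + σ * y)).hasDerivAt).comp y h1
      exact this.congr_deriv (by ring)) i1 (i2.const_mul σ) iy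
  rw [integral_const_mul] at ibp
  have L1 : ∫ y, F' s y ∂(ProbabilityTheory.gaussianReal 0 (1 / 2))
      = (-(1 / 2) * a) * ∫ y, deriv f (a + σ * y) ∂(ProbabilityTheory.gaussianReal 0 (1 / 2))
        + Real.exp (-s) / (2 * σ)
          * ∫ y, y * deriv f (a + σ * y) ∂(ProbabilityTheory.gaussianReal 0 (1 / 2)) := by
    rw [← integral_const_mul, ← integral_const_mul,
      ← integral_add (i1.const_mul _) (iy.const_mul _)]
    refine integral_congr_ae (Filter.Eventually.of_forall fun y => ?_)
    simp only [hF', ha]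
    ring
  have L2 : ouSemigroupOne s (ouGenerator f) x
      = 1 / 4 * ∫ y, deriv (deriv f) (a + σ * y) ∂(ProbabilityTheory.gaussianReal 0 (1 / 2))
        + (-(1 / 2) * a) * ∫ y, deriv f (a + σ * y) ∂(ProbabilityTheory.gaussianReal 0 (1 / 2))
        + (-(1 / 2) * σ)
          * ∫ y, y * deriv f (a + σ * y) ∂(ProbabilityTheory.gaussianReal 0 (1 / 2)) := by
    rw [← integral_linear_combination₃ i2 i1 iy]
    refine integral_congr_ae (Filter.Eventually.of_forall fun y => ?_)
    simp only [ouGenerator]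
    ring
  rw [L1, L2, ibp, show Real.exp (-s) = 1 - σ ^ 2 by rw [hσ2]; ring]
  field_simp
  ring

theorem ouSemigroupOne_zero (f : ℝ → ℝ) (x : ℝ) : ouSemigroupOne 0 f x = f x := by
  simp [ouSemigroupOne]

/-- Invariance of the reference measure. -/
theorem integral_ouSemigroupOne {f : ℝ → ℝ} {M t : ℝ} (hf : Continuous f) (hM : ∀ x, |f x| ≤ M)
    (ht : 0 ≤ t) : ∫ x, ouSemigroupOne t f x ∂ouMeasure = ∫ x, f x ∂ouMeasure := by
  rw [integral_ouMeasure_eq_gaussianReal, integral_ouMeasure_eq_gaussianReal]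
  congr 1
  set γ := ProbabilityTheory.gaussianReal 0 (1 / 2) with hγ
  have hσ : 0 ≤ 1 - Real.exp (-t) := by
    have : Real.exp (-t) ≤ 1 := Real.exp_le_one_iff.2 (by linarith)
    linarith
  -- The variances e^{-t}/2 and (1 - e^{-t})/2 add up to 1/2.
  have hconv : (γ.map (fun x => Real.exp (-t / 2) * x)).conv
      (γ.map (fun y => √(1 - Real.exp (-t)) * y)) = γ := by
    rw [hγ, ProbabilityTheory.gaussianReal_map_const_mul,
      ProbabilityTheory.gaussianReal_map_const_mul,
      ProbabilityTheory.gaussianReal_conv_gaussianReal]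
    congr 1
    · simp
    · ext
      push_cast
      rw [Real.sq_sqrt hσ, ← Real.exp_nat_mul]
      push_cast
      rw [show 2 * (-t / 2) = -t by ring]
      ring
  have m1 : AEMeasurable (fun x : ℝ => Real.exp (-t / 2) * x) γ := by fun_prop
  have m2 : AEMeasurable (fun y : ℝ => √(1 - Real.exp (-t)) * y) γ := by fun_prop
  have := Measure.isProbabilityMeasure_map m1
  have := Measure.isProbabilityMeasure_map m2
  conv_rhs => rw [← hconv]
  rw [integral_conv ((integrable_const M).mono' hf.aestronglyMeasurable
    (Filter.Eventually.of_forall hM))]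
  have hin : ∀ z : ℝ, ∫ w, f (z + w) ∂(γ.map (fun y => √(1 - Real.exp (-t)) * y))
      = ∫ y, f (z + √(1 - Real.exp (-t)) * y) ∂γ := fun z =>
    integral_map m2 (hf.comp (by fun_prop)).aestronglyMeasurable
  simp_rw [hin]
  rw [integral_map m1]
  · rfl
  · refine (continuous_of_dominated (bound := fun _ => M) (fun p => ?_) (fun p => ?_)
      (integrable_const M) (Filter.Eventually.of_forall fun y => ?_)).aestronglyMeasurable
    · exact (hf.comp (by fun_prop)).aestronglyMeasurable
    · exact Filter.Eventually.of_forall fun y => hM _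
    · exact hf.comp (by fun_prop)

theorem ouSemigroupOne_backwardDensity {v : ℝ → ℝ} {M : ℝ} (h0 : DerivLE 0 M (fun _ => 1) v)
    (h1 : DerivLE 0 M (fun _ => 1) (ouGenerator v))
    (h2 : DerivLE 0 M (fun _ => 1) (ouGenerator (ouGenerator v))) (s r x : ℝ) :
    ouSemigroupOne s (backwardDensity r v) x = ouSemigroupOne s v x
      - r * ouSemigroupOne s (ouGenerator v) x
      + 1 / 2 * r ^ 2 * ouSemigroupOne s (ouGenerator (ouGenerator v)) x := by
  unfold ouSemigroupOne backwardDensity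
  have i0 := integrable_comp_affine_gaussianReal h0.continuous
    (fun x => by simpa using h0.bound x) (Real.exp (-s / 2) * x) √(1 - Real.exp (-s))
  have i1 := integrable_comp_affine_gaussianReal h1.continuous
    (fun x => by simpa using h1.bound x) (Real.exp (-s / 2) * x) √(1 - Real.exp (-s))
  have i2 := integrable_comp_affine_gaussianReal h2.continuous
    (fun x => by simpa using h2.bound x) (Real.exp (-s / 2) * x) √(1 - Real.exp (-s))
  have h := integral_linear_combination₃ i0 i1 i2 1 (-r) (1 / 2 * r ^ 2)
  rw [one_mul, neg_mul, ← sub_eq_add_neg] at h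
  rw [← h]
  simp only [one_mul, neg_mul, ← sub_eq_add_neg]

/-- The forward semigroup applied to the approximate backward evolution returns `v` up to third
order. -/
theorem abs_ouSemigroupOne_backwardDensity_sub_le {v : ℝ → ℝ} {M : ℝ}
    (h0 : DerivLE 2 M (fun _ => 1) v) (h1 : DerivLE 2 M (fun _ => 1) (ouGenerator v))
    (h2 : DerivLE 2 M (fun _ => 1) (ouGenerator (ouGenerator v))) {t x D : ℝ} (ht : 0 < t)
    (hD : ∀ s, 0 < s → s < t →
      |ouSemigroupOne s (ouGenerator (ouGenerator (ouGenerator v))) x| ≤ D) :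
    |ouSemigroupOne t (backwardDensity t v) x - v x| ≤ t ^ 3 * D := by
  set φ : ℝ → ℝ := fun s => ouSemigroupOne s v x - s * ouSemigroupOne s (ouGenerator v) x
      + 1 / 2 * s ^ 2 * ouSemigroupOne s (ouGenerator (ouGenerator v)) x with hφ
  have cont : ∀ {f : ℝ → ℝ}, DerivLE 2 M (fun _ => 1) f →
      Continuous fun s => ouSemigroupOne s f x := fun {f} hf =>
    (continuous_ouSemigroupOne_uncurry hf.continuous
      (fun x => by simpa using hf.bound x)).comp (Continuous.prodMk continuous_id continuous_const)
  have c0 := cont h0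
  have c1 := cont h1
  have c2 := cont h2
  -- Mean value theorem on [0, t], which needs only continuity at s = 0. In φ' the terms e^{sL}Lv
  -- and s e^{sL}L²v occur with both signs and cancel.
  obtain ⟨s, ⟨hs0, hst⟩, hs⟩ := exists_hasDerivAt_eq_slope φ
    (fun s => 1 / 2 * s ^ 2 * ouSemigroupOne s (ouGenerator (ouGenerator (ouGenerator v))) x)
    ht (by simp only [hφ]; fun_prop) (fun s hs => by
      have d := ((hasDerivAt_ouSemigroupOne h0 x hs.1).sub
        ((hasDerivAt_id s).mul (hasDerivAt_ouSemigroupOne h1 x hs.1))).add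
        ((((hasDerivAt_id s).pow 2).const_mul (1 / 2)).mul (hasDerivAt_ouSemigroupOne h2 x hs.1))
      refine d.congr_deriv ?_
      simp)
  have e0 : φ 0 = v x := by simp [hφ, ouSemigroupOne_zero]
  have et : φ t = ouSemigroupOne t (backwardDensity t v) x :=
    (ouSemigroupOne_backwardDensity h0.of_succ.of_succ h1.of_succ.of_succ h2.of_succ.of_succ
      t t x).symm
  rw [e0, et, sub_zero, eq_div_iff ht.ne'] at hs
  rw [← hs, abs_mul, abs_mul, abs_of_pos ht, abs_of_nonneg (by positivity)]
  have hD' := hD s hs0 hst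
  have hD0 : 0 ≤ D := (abs_nonneg _).trans hD'
  calc 1 / 2 * s ^ 2 * |ouSemigroupOne s (ouGenerator (ouGenerator (ouGenerator v))) x| * t
      ≤ 1 * t ^ 2 * D * t := by gcongr; norm_num
    _ = _ := by ring

/-! ### Tensor powers -/

theorem integrable_tensorPow {f : ℝ → ℝ} (hf : Integrable f ouMeasure) (n : ℕ) :
    Integrable (tensorPow n f) (ouMeasurePi n) :=
  Integrable.fintype_prod (f := fun _ : Fin n => f) fun _ => hf

theorem integral_tensorPow (f : ℝ → ℝ) (n : ℕ) :
    ∫ x, tensorPow n f x ∂(ouMeasurePi n) = (∫ x, f x ∂ouMeasure) ^ n := by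
  unfold tensorPow ouMeasurePi
  rw [integral_fintype_prod_eq_pow, Fintype.card_fin]

theorem integral_abs_tensorPow_sub_le {u v : ℝ → ℝ} (hu : IsOUDensity u) (hv : IsOUDensity v)
    (n : ℕ) :
    Integrable (fun x => |tensorPow n v x - tensorPow n u x|) (ouMeasurePi n) ∧
      ∫ x, |tensorPow n v x - tensorPow n u x| ∂(ouMeasurePi n)
        ≤ n * ∫ x, |v x - u x| ∂ouMeasure := by
  obtain ⟨hu0, hui, hu1⟩ := hu
  obtain ⟨hv0, hvi, hv1⟩ := hv
  have hint : Integrable (fun x => |tensorPow n v x - tensorPow n u x|) (ouMeasurePi n) :=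
    ((integrable_tensorPow hvi n).sub (integrable_tensorPow hui n)).abs
  refine ⟨hint, ?_⟩
  -- The j-th factor in the i-th telescoping term: v before position i, |v - u| at it, u after it.
  -- Only the factor at i has an integral different from 1.
  set h : Fin n → Fin n → ℝ → ℝ := fun i j x =>
    if j < i then v x else if i < j then u x else |v x - u x| with hh
  have hi : ∀ i j, Integrable (h i j) ouMeasure := fun i j => by
    simp only [hh]
    split_ifs
    · exact hvi
    · exact hui
    · exact (hvi.sub hui).abs
  have hprod : ∀ i (x : Fin n → ℝ), |v (x i) - u (x i)| * (∏ j with j < i, v (x j))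
      * (∏ j with i < j, u (x j)) = ∏ j, h i j (x j) := fun i x => by
    rw [← Finset.mul_prod_erase Finset.univ _ (Finset.mem_univ i)]
    have e1 : h i i (x i) = |v (x i) - u (x i)| := by simp [hh]
    rw [e1, mul_assoc, ← Finset.prod_filter_mul_prod_filter_not (Finset.univ.erase i) (· < i)]
    congr 2
    · refine Finset.prod_congr ?_ fun j hj => ?_
      · ext j
        simp only [Finset.mem_filter, Finset.mem_univ, true_and, Finset.mem_erase, ne_eq, and_true]
        exact ⟨fun h => ⟨h.ne, h⟩, fun h => h.2⟩
      · have : j < i := (Finset.mem_filter.1 hj).2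
        simp [hh, this]
    · refine Finset.prod_congr ?_ fun j hj => ?_
      · ext j
        simp only [Finset.mem_filter, Finset.mem_univ, true_and, Finset.mem_erase, ne_eq, and_true,
          not_lt]
        exact ⟨fun h => ⟨h.ne', h.le⟩, fun h => lt_of_le_of_ne h.2 (Ne.symm h.1)⟩
      · have h1 := (Finset.mem_filter.1 hj).2
        have h2 := (Finset.mem_erase.1 (Finset.mem_filter.1 hj).1).1
        have : i < j := lt_of_le_of_ne (not_lt.1 h1) (Ne.symm h2)
        simp [hh, this, this.not_gt]
  have hpt : ∀ x : Fin n → ℝ, |tensorPow n v x - tensorPow n u x| ≤ ∑ i, ∏ j, h i j (x j) := by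
    intro x
    have e := Finset.prod_add_ordered Finset.univ (fun i => u (x i)) (fun i => v (x i) - u (x i))
    simp only [add_sub_cancel] at e
    have : tensorPow n v x - tensorPow n u x = ∑ i, (v (x i) - u (x i)) *
        (∏ j with j < i, v (x j)) * ∏ j with i < j, u (x j) := by
      unfold tensorPow; rw [e]; ring
    rw [this]
    refine (Finset.abs_sum_le_sum_abs _ _).trans (le_of_eq (Finset.sum_congr rfl fun i _ => ?_))
    rw [← hprod, abs_mul, abs_mul, abs_of_nonneg (Finset.prod_nonneg fun j _ => hv0 _),
      abs_of_nonneg (Finset.prod_nonneg fun j _ => hu0 _)]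
  have hpi : ∀ i, Integrable (fun x : Fin n → ℝ => ∏ j, h i j (x j)) (ouMeasurePi n) := fun i =>
    Integrable.fintype_prod (f := h i) (hi i)
  calc ∫ x, |tensorPow n v x - tensorPow n u x| ∂(ouMeasurePi n)
      ≤ ∫ x, ∑ i, ∏ j, h i j (x j) ∂(ouMeasurePi n) :=
        integral_mono hint (integrable_finsetSum _ fun i _ => hpi i) hpt
    _ = ∑ i, ∫ x, ∏ j, h i j (x j) ∂(ouMeasurePi n) := integral_finsetSum _ fun i _ => hpi i
    _ = ∑ _i : Fin n, ∫ x, |v x - u x| ∂ouMeasure := by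
        refine Finset.sum_congr rfl fun i _ => ?_
        unfold ouMeasurePi
        rw [integral_fintype_prod_eq_prod, Finset.prod_eq_single i]
        · simp [hh]
        · intro j _ hj
          rcases lt_or_gt_of_ne hj with h1 | h1
          · simp [hh, h1, hv1]
          · simp [hh, h1, h1.not_gt, hu1]
        · simp
    _ = _ := by simp

/-- Tensorisation of the `χ²` distance. -/
theorem integral_sq_tensorPow_sub_div {v w : ℝ → ℝ} (hv : IsOUDensity v) (hw : IsOUDensity w)
    (hw0 : ∀ x, 0 < w x) (hi : Integrable (fun x => (w x - v x) ^ 2 / w x) ouMeasure) (n : ℕ) :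
    Integrable (fun x => |tensorPow n w x - tensorPow n v x| ^ 2 / tensorPow n w x)
        (ouMeasurePi n) ∧
      ∫ x, |tensorPow n w x - tensorPow n v x| ^ 2 / tensorPow n w x ∂(ouMeasurePi n)
        = (1 + ∫ x, (w x - v x) ^ 2 / w x ∂ouMeasure) ^ n - 1 := by
  obtain ⟨-, hvi, hv1⟩ := hv
  obtain ⟨-, hwi, hw1⟩ := hw
  -- Expanding the square, (w-v)²/w = v²/w - 2v + w. The last two terms have known mass and v²/w is
  -- multiplicative over coordinates, which is what makes χ² tensorise.
  have e1 : (fun x => v x ^ 2 / w x)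
      = fun x => 1 * ((w x - v x) ^ 2 / w x) + 2 * v x + (-1) * w x := by
    ext x
    have := (hw0 x).ne'
    field_simp
    ring
  have i1 : Integrable (fun x => v x ^ 2 / w x) ouMeasure := by
    rw [e1]; exact ((hi.const_mul 1).add (hvi.const_mul 2)).add (hwi.const_mul (-1))
  have v1 : ∫ x, v x ^ 2 / w x ∂ouMeasure = 1 + ∫ x, (w x - v x) ^ 2 / w x ∂ouMeasure := by
    rw [e1, integral_linear_combination₃ hi hvi hwi, hv1, hw1]; ring
  have e2 : (fun x => |tensorPow n w x - tensorPow n v x| ^ 2 / tensorPow n w x)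
      = fun x => 1 * tensorPow n (fun x => v x ^ 2 / w x) x + (-2) * tensorPow n v x
        + 1 * tensorPow n w x := by
    ext x
    have h0 : tensorPow n w x ≠ 0 := (Finset.prod_pos fun i _ => hw0 _).ne'
    have h1 : tensorPow n (fun x => v x ^ 2 / w x) x = tensorPow n v x ^ 2 / tensorPow n w x := by
      simp [tensorPow, Finset.prod_div_distrib, Finset.prod_pow]
    rw [h1, sq_abs]
    field_simp
    ring
  have j1 := integrable_tensorPow i1 n
  have j2 := integrable_tensorPow hvi n
  have j3 := integrable_tensorPow hwi n
  refine ⟨?_, ?_⟩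
  · rw [e2]; exact ((j1.const_mul 1).add (j2.const_mul (-2))).add (j3.const_mul 1)
  · rw [e2, integral_linear_combination₃ j1 j2 j3, integral_tensorPow, integral_tensorPow,
      integral_tensorPow, v1, hv1, hw1]
    ring

theorem one_add_pow_sub_one_le {n : ℕ} {e : ℝ} (he : 0 ≤ e) (hn : n * e ≤ 1) :
    (1 + e) ^ n - 1 ≤ 2 * (n * e) := by
  have h1 : (1 + e) ^ n ≤ Real.exp (n * e) := by
    rw [Real.exp_nat_mul]
    gcongr
    linarith [Real.add_one_le_exp e]
  have h0 : (0 : ℝ) ≤ n * e := by positivity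
  have h2 := Real.abs_exp_sub_one_le (x := n * e) (by rwa [abs_of_nonneg h0])
  rw [abs_of_nonneg h0] at h2
  linarith [le_abs_self (Real.exp (n * e) - 1)]

/-! ### The approximate backward evolution in one dimension -/

/-- The displacement is split into noise and drift. The noise has size at most √s |y| and costs B₁√s
|y| ≤ |y|. The drift follows r ↦ e^{-r/2}x, whose velocity is -1/2 times the position, so a bound on
x W'(x) suffices and the cost is at most sB₂/2. -/
theorem abs_sub_le_of_abs_deriv_le {W : ℝ → ℝ} (hW : Differentiable ℝ W) {B₁ B₂ s : ℝ}
    (h₁ : ∀ x, |deriv W x| ≤ B₁) (h₂ : ∀ x, |x * deriv W x| ≤ B₂) (hs : 0 ≤ s)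
    (hs₁ : s * B₁ ^ 2 ≤ 1) (hs₂ : s * B₂ ≤ 1) (x y : ℝ) :
    |W (Real.exp (-s / 2) * x + √(1 - Real.exp (-s)) * y) - W x| ≤ 1 + |y| := by
  have hB₁ : 0 ≤ B₁ := (abs_nonneg _).trans (h₁ 0)
  have hB₂ : 0 ≤ B₂ := (abs_nonneg _).trans (h₂ 0)
  have e1 : |W (Real.exp (-s / 2) * x + √(1 - Real.exp (-s)) * y) - W (Real.exp (-s / 2) * x)|
      ≤ |y| := by
    have h := Convex.norm_image_sub_le_of_norm_deriv_le (f := W) (s := Set.univ) (C := B₁)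
      (x := Real.exp (-s / 2) * x) (y := Real.exp (-s / 2) * x + √(1 - Real.exp (-s)) * y)
      (fun x _ => hW x) (fun x _ => h₁ x) convex_univ trivial trivial
    rw [Real.norm_eq_abs, Real.norm_eq_abs, add_sub_cancel_left, abs_mul,
      abs_of_nonneg (Real.sqrt_nonneg _)] at h
    refine h.trans ?_
    have h3 : √(1 - Real.exp (-s)) ≤ √s :=
      Real.sqrt_le_sqrt (by linarith [Real.add_one_le_exp (-s)])
    have h4 : B₁ * √s ≤ 1 := by
      refine abs_le_one_iff_mul_self_le_one.2 ?_ |> (le_abs_self _).trans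
      have := Real.mul_self_sqrt hs
      nlinarith
    calc B₁ * (√(1 - Real.exp (-s)) * |y|) ≤ B₁ * (√s * |y|) := by gcongr
      _ = (B₁ * √s) * |y| := by ring
      _ ≤ 1 * |y| := by gcongr
      _ = |y| := one_mul _
  have e2 : |W (Real.exp (-s / 2) * x) - W x| ≤ 1 := by
    have hd : ∀ r : ℝ, HasDerivAt (fun r => W (Real.exp (-r / 2) * x))
        (deriv W (Real.exp (-r / 2) * x) * (Real.exp (-r / 2) * (-1 / 2) * x)) r := fun r => by
      have h1 : HasDerivAt (fun r : ℝ => Real.exp (-r / 2)) (Real.exp (-r / 2) * (-1 / 2)) r :=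
        ((hasDerivAt_id r).neg.div_const 2).exp
      exact (hW (Real.exp (-r / 2) * x)).hasDerivAt.comp r (h1.mul_const x)
    have h := Convex.norm_image_sub_le_of_norm_deriv_le (f := fun r => W (Real.exp (-r / 2) * x))
      (s := Set.univ) (C := B₂) (x := 0) (y := s)
      (fun r _ => (hd r).differentiableAt) (fun r _ => by
        rw [(hd r).deriv, Real.norm_eq_abs]
        have h3 := h₂ (Real.exp (-r / 2) * x)
        have : deriv W (Real.exp (-r / 2) * x) * (Real.exp (-r / 2) * (-1 / 2) * x)
          = -(1 / 2) * (Real.exp (-r / 2) * x * deriv W (Real.exp (-r / 2) * x)) := by ring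
        rw [this, abs_mul]
        have : |(-(1 / 2) : ℝ)| = 1 / 2 := by rw [abs_neg, abs_of_pos (by norm_num)]
        rw [this]
        linarith) convex_univ trivial trivial
    rw [Real.norm_eq_abs, Real.norm_eq_abs, sub_zero, abs_of_nonneg hs] at h
    simp only [neg_zero, zero_div, Real.exp_zero, one_mul] at h
    linarith
  calc _ ≤ |W (Real.exp (-s / 2) * x + √(1 - Real.exp (-s)) * y) - W (Real.exp (-s / 2) * x)|
        + |W (Real.exp (-s / 2) * x) - W x| := abs_sub_le _ _ _
    _ ≤ |y| + 1 := add_le_add e1 e2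
    _ = _ := add_comm _ _

/-- Polynomial weights pass through the flow because the squares of its two coefficients sum to 1.
-/
theorem one_add_sq_ouFlow_le (s x y : ℝ) (hs : 0 ≤ s) :
    1 + (Real.exp (-s / 2) * x + √(1 - Real.exp (-s)) * y) ^ 2
      ≤ 2 * ((1 + x ^ 2) * (1 + y ^ 2)) := by
  have h1 : Real.exp (-s) ≤ 1 := Real.exp_le_one_iff.2 (by linarith)
  have h0 := Real.exp_pos (-s)
  have ha : Real.exp (-s / 2) ^ 2 = Real.exp (-s) := by
    rw [← Real.exp_nat_mul]; congr 1; push_cast; ring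
  have hb : √(1 - Real.exp (-s)) ^ 2 = 1 - Real.exp (-s) := Real.sq_sqrt (by linarith)
  have h2 := sq_nonneg (Real.exp (-s / 2) * x - √(1 - Real.exp (-s)) * y)
  nlinarith [mul_nonneg (sq_nonneg x) (sq_nonneg y), mul_nonneg h0.le (sq_nonneg y),
    mul_nonneg (sub_nonneg.2 h1) (sq_nonneg x), sq_nonneg x, sq_nonneg y]

theorem abs_ouSemigroupOne_le_of_abs_le {W h : ℝ → ℝ} {K s x : ℝ} {m : ℕ} (hK : 0 ≤ K)
    (hs : 0 ≤ s)
    (hW : ∀ y, |W (Real.exp (-s / 2) * x + √(1 - Real.exp (-s)) * y) - W x| ≤ 1 + |y|)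
    (hh : ∀ x, |h x| ≤ K * (1 + x ^ 2) ^ m * Real.exp (W x)) :
    |ouSemigroupOne s h x| ≤ K * (2 ^ m * Real.exp 1 * ∫ y, (1 + y ^ 2) ^ m * Real.exp |y|
      ∂(ProbabilityTheory.gaussianReal 0 (1 / 2))) * (1 + x ^ 2) ^ m * Real.exp (W x) := by
  have key : ∀ y, ‖h (Real.exp (-s / 2) * x + √(1 - Real.exp (-s)) * y)‖
      ≤ K * (2 ^ m * Real.exp 1) * (1 + x ^ 2) ^ m * Real.exp (W x)
        * ((1 + y ^ 2) ^ m * Real.exp |y|) := fun y => by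
    refine (hh _).trans ?_
    have h1 := pow_le_pow_left₀ (by positivity) (one_add_sq_ouFlow_le s x y hs) m
    rw [mul_pow, mul_pow] at h1
    have h2 : Real.exp (W (Real.exp (-s / 2) * x + √(1 - Real.exp (-s)) * y))
        ≤ Real.exp (W x) * (Real.exp 1 * Real.exp |y|) := by
      rw [← Real.exp_add, ← Real.exp_add]
      exact Real.exp_le_exp.2 (by linarith [(abs_le.1 (hW y)).2])
    calc _ ≤ K * (2 ^ m * ((1 + x ^ 2) ^ m * (1 + y ^ 2) ^ m))
          * (Real.exp (W x) * (Real.exp 1 * Real.exp |y|)) := by gcongr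
      _ = _ := by ring
  have := norm_integral_le_of_norm_le ((integrable_one_add_sq_pow_mul_exp_abs m).const_mul
    (K * (2 ^ m * Real.exp 1) * (1 + x ^ 2) ^ m * Real.exp (W x)))
    (Filter.Eventually.of_forall key)
  rw [integral_const_mul] at this
  refine this.trans_eq ?_
  ring

theorem integrable_exp_neg_abs_gaussianReal :
    Integrable (fun y : ℝ => Real.exp (-|y|)) (ProbabilityTheory.gaussianReal 0 (1 / 2)) :=
  (integrable_const (1 : ℝ)).mono' (by fun_prop) (Filter.Eventually.of_forall fun y => by simp)

theorem integral_exp_neg_abs_gaussianReal_pos :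
    0 < ∫ y, Real.exp (-|y|) ∂(ProbabilityTheory.gaussianReal 0 (1 / 2)) :=
  integral_exp_pos integrable_exp_neg_abs_gaussianReal

/-- Along the flow e^W drops at most by the factor e^{-1-|y|}, whose Gaussian mean is positive. -/
theorem le_ouSemigroupOne_of_le {W g : ℝ → ℝ} {M b s x : ℝ} (hb : 0 ≤ b) (hg : Continuous g)
    (hM : ∀ x, |g x| ≤ M)
    (hW : ∀ y, |W (Real.exp (-s / 2) * x + √(1 - Real.exp (-s)) * y) - W x| ≤ 1 + |y|)
    (hbg : ∀ x, b * Real.exp (W x) ≤ g x) :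
    b * Real.exp (-1) * (∫ y, Real.exp (-|y|) ∂(ProbabilityTheory.gaussianReal 0 (1 / 2)))
      * Real.exp (W x) ≤ ouSemigroupOne s g x := by
  have e : b * Real.exp (-1) * (∫ y, Real.exp (-|y|)
      ∂(ProbabilityTheory.gaussianReal 0 (1 / 2))) * Real.exp (W x)
      = ∫ y, (b * Real.exp (-1) * Real.exp (W x)) * Real.exp (-|y|)
        ∂(ProbabilityTheory.gaussianReal 0 (1 / 2)) := by
    rw [integral_const_mul]; ring
  rw [e]
  refine integral_mono (integrable_exp_neg_abs_gaussianReal.const_mul _)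
    (integrable_comp_affine_gaussianReal hg hM _ _) fun y => ?_
  refine le_trans ?_ (hbg _)
  have h2 : Real.exp (-1) * Real.exp (W x) * Real.exp (-|y|)
      ≤ Real.exp (W (Real.exp (-s / 2) * x + √(1 - Real.exp (-s)) * y)) := by
    rw [← Real.exp_add, ← Real.exp_add]
    exact Real.exp_le_exp.2 (by linarith [(abs_le.1 (hW y)).1])
  calc _ = b * (Real.exp (-1) * Real.exp (W x) * Real.exp (-|y|)) := by ring
    _ ≤ _ := by gcongr

/-! ### Functions that are constant outside a compact interval -/

theorem exists_derivLE_of_eq_const_outside {f : ℝ → ℝ} {n : ℕ} (hf : ContDiff ℝ n f) {c R : ℝ}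
    (hc : ∀ x, R < |x| → f x = c) : ∃ M : ℝ, 0 ≤ M ∧ DerivLE n M (fun _ => 1) f := by
  have hs : HasCompactSupport (fun x => f x - c) := by
    refine HasCompactSupport.intro (isCompact_Icc (a := -R) (b := R)) fun x hx => ?_
    rw [hc x, sub_self]
    by_contra hcon
    exact hx ⟨(abs_le.1 (not_lt.1 hcon)).1, (abs_le.1 (not_lt.1 hcon)).2⟩
  obtain ⟨M, hM, h⟩ := DerivLE.exists_of_hasCompactSupport (hf.sub contDiff_const) hs
  refine ⟨M + |c|, by positivity, ?_⟩
  simpa using h.add (DerivLE.const c)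

theorem isOpen_lt_abs (R : ℝ) : IsOpen {x : ℝ | R < |x|} :=
  isOpen_lt continuous_const continuous_abs

theorem le_of_mul_one_add_le_one {x B L : ℝ} (hx : 0 ≤ x) (hB : 0 ≤ B) (hL : 0 ≤ L)
    (h : x * (1 + B + B ^ 2 + 4 * L) ≤ 1) :
    x ≤ 1 ∧ x * B ≤ 1 ∧ x * B ^ 2 ≤ 1 ∧ x * L ≤ 1 / 4 := by
  have h1 := mul_nonneg hx hB
  have h2 := mul_nonneg hx (sq_nonneg B)
  have h3 := mul_nonneg hx hL
  have e : x * (1 + B + B ^ 2 + 4 * L) = x + x * B + x * B ^ 2 + 4 * (x * L) := by ring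
  refine ⟨?_, ?_, ?_, ?_⟩ <;> linarith

theorem deriv_eq_zero_of_eq_const_outside {f : ℝ → ℝ} {c R : ℝ} (hc : ∀ x, R < |x| → f x = c)
    {x : ℝ} (hx : R < |x|) : deriv f x = 0 := by
  have h1 : f =ᶠ[nhds x] fun _ => c := Filter.mem_of_superset ((isOpen_lt_abs _).mem_nhds hx) hc
  rw [h1.deriv.eq_of_nhds]; simp

theorem ouGenerator_eq_zero_of_eq_const_outside {f : ℝ → ℝ} {c R : ℝ}
    (hc : ∀ x, R < |x| → f x = c) {x : ℝ} (hx : R < |x|) : ouGenerator f x = 0 :=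
  ouGenerator_eq_zero_of_eq_const (isOpen_lt_abs R) hc hx

theorem integral_ouGenerator_of_eq_const_outside {f : ℝ → ℝ} {c R : ℝ} (hf : ContDiff ℝ 2 f)
    (hc : ∀ x, R < |x| → f x = c) :
    Integrable (ouGenerator f) ouMeasure ∧ ∫ x, ouGenerator f x ∂ouMeasure = 0 := by
  refine integral_ouGenerator hf (HasCompactSupport.intro (isCompact_Icc (a := -R) (b := R))
    fun x hx => deriv_eq_zero_of_eq_const_outside hc ?_)
  by_contra hcon
  exact hx ⟨(abs_le.1 (not_lt.1 hcon)).1, (abs_le.1 (not_lt.1 hcon)).2⟩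

/-- The bound M is qualitative: it depends on v and serves only to justify the calculus of the
semigroup. It enters none of the final constants. -/
theorem exists_derivLE_iterate_ouGenerator {v : ℝ → ℝ} {c R : ℝ} (hv : ContDiff ℝ 6 v)
    (hc : ∀ x, R < |x| → v x = c) :
    ∃ M : ℝ, DerivLE 2 M (fun _ => 1) v ∧ DerivLE 2 M (fun _ => 1) (ouGenerator v) ∧
      DerivLE 2 M (fun _ => 1) (ouGenerator (ouGenerator v)) := by
  have c0 : ContDiff ℝ (4 + 2 : ℕ) v := by exact_mod_cast hv
  have c1 : ContDiff ℝ (2 + 2 : ℕ) (ouGenerator v) := contDiff_ouGenerator c0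
  have c2 : ContDiff ℝ (2 : ℕ) (ouGenerator (ouGenerator v)) := contDiff_ouGenerator c1
  have z1 : ∀ x, R < |x| → ouGenerator v x = 0 := fun x hx =>
    ouGenerator_eq_zero_of_eq_const_outside hc hx
  have z2 : ∀ x, R < |x| → ouGenerator (ouGenerator v) x = 0 := fun x hx =>
    ouGenerator_eq_zero_of_eq_const_outside z1 hx
  obtain ⟨M₀, hM₀, d0⟩ := exists_derivLE_of_eq_const_outside c0 hc
  obtain ⟨M₁, hM₁, d1⟩ := exists_derivLE_of_eq_const_outside c1 z1
  obtain ⟨M₂, hM₂, d2⟩ := exists_derivLE_of_eq_const_outside c2 z2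
  refine ⟨M₀ + M₁ + M₂, (d0.of_le (by norm_num)).mono_weight fun x => ?_,
    (d1.of_le (by norm_num)).mono_weight fun x => ?_, d2.mono_weight fun x => ?_⟩ <;>
  · simp only [mul_one]; linarith

theorem isOUDensity_backwardDensity {v : ℝ → ℝ} {c R t : ℝ} (hv : ContDiff ℝ 6 v)
    (hc : ∀ x, R < |x| → v x = c) (hd : IsOUDensity v) (h0 : ∀ x, 0 ≤ backwardDensity t v x) :
    IsOUDensity (backwardDensity t v) := by
  have z1 : ∀ x, R < |x| → ouGenerator v x = 0 := fun x hx =>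
    ouGenerator_eq_zero_of_eq_const_outside hc hx
  have c1 : ContDiff ℝ (2 : ℕ) (ouGenerator v) :=
    contDiff_ouGenerator (hv.of_le (by norm_num))
  have int1 := integral_ouGenerator_of_eq_const_outside (hv.of_le (by norm_num)) hc
  have int2 := integral_ouGenerator_of_eq_const_outside c1 z1
  have hlin : backwardDensity t v = fun x => 1 * v x + (-t) * ouGenerator v x
      + (1 / 2 * t ^ 2) * ouGenerator (ouGenerator v) x := by
    ext x
    rw [backwardDensity]; ring
  refine ⟨h0, ?_, ?_⟩
  · rw [hlin]
    exact ((hd.2.1.const_mul 1).add (int1.1.const_mul _)).add (int2.1.const_mul _)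
  · rw [hlin, integral_linear_combination₃ hd.2.1 int1.1 int2.1, hd.2.2, int1.2, int2.2]
    ring

theorem isOUDensity_ouSemigroupOne {g : ℝ → ℝ} {M t : ℝ} (hg : Continuous g)
    (hM : ∀ x, |g x| ≤ M) (hd : IsOUDensity g) (ht : 0 ≤ t) :
    IsOUDensity (ouSemigroupOne t g) := by
  have hc : Continuous (ouSemigroupOne t g) :=
    (continuous_ouSemigroupOne_uncurry hg hM).comp
      (Continuous.prodMk continuous_const continuous_id)
  refine ⟨fun x => integral_nonneg fun y => hd.1 _, ?_, ?_⟩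
  · refine (integrable_const M).mono' hc.aestronglyMeasurable
      (Filter.Eventually.of_forall fun x => ?_)
    have := norm_integral_le_of_norm_le_const
      (μ := ProbabilityTheory.gaussianReal 0 (1 / 2))
      (f := fun y => g (Real.exp (-t / 2) * x + √(1 - Real.exp (-t)) * y))
      (Filter.Eventually.of_forall fun y => hM _)
    rwa [probReal_univ, mul_one] at this
  · rw [integral_ouSemigroupOne hg hM ht, hd.2.2]

/-- The squared error carries v² and the denominator is at least b v, so one factor v remains to
integrate the polynomial weight. -/
theorem integral_sq_sub_div_le {v w : ℝ → ℝ} {T b J : ℝ} {m : ℕ} (hb : 0 < b)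
    (hvc : Continuous v) (hwc : Continuous w) (hv0 : ∀ x, 0 < v x) (hlow : ∀ x, b * v x ≤ w x)
    (hdiff : ∀ x, |w x - v x| ≤ T * (1 + x ^ 2) ^ m * v x)
    (hi : Integrable (fun x => (1 + x ^ 2) ^ (2 * m) * v x) ouMeasure)
    (hiJ : ∫ x, (1 + x ^ 2) ^ (2 * m) * v x ∂ouMeasure ≤ J) :
    Integrable (fun x => (w x - v x) ^ 2 / w x) ouMeasure ∧
      ∫ x, (w x - v x) ^ 2 / w x ∂ouMeasure ≤ T ^ 2 / b * J := by
  have hwpos : ∀ x, 0 < w x := fun x => lt_of_lt_of_le (mul_pos hb (hv0 x)) (hlow x)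
  have hsq : ∀ x, (w x - v x) ^ 2 / w x ≤ T ^ 2 / b * ((1 + x ^ 2) ^ (2 * m) * v x) := fun x => by
    rw [div_le_iff₀ (hwpos x)]
    have h1 : (w x - v x) ^ 2 ≤ (T * (1 + x ^ 2) ^ m * v x) ^ 2 := by
      rw [← sq_abs]; exact pow_le_pow_left₀ (abs_nonneg _) (hdiff x) 2
    have := (hv0 x).le
    calc (w x - v x) ^ 2 ≤ (T * (1 + x ^ 2) ^ m * v x) ^ 2 := h1
      _ = T ^ 2 / b * ((1 + x ^ 2) ^ (2 * m) * v x) * (b * v x) := by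
          rw [mul_pow, mul_pow, ← pow_mul, mul_comm m 2]
          field_simp
      _ ≤ _ := by gcongr; exact hlow x
  have hint : Integrable (fun x => (w x - v x) ^ 2 / w x) ouMeasure := by
    refine (hi.const_mul (T ^ 2 / b)).mono'
      (((hwc.sub hvc).pow 2).div hwc fun x => (hwpos x).ne').aestronglyMeasurable
      (Filter.Eventually.of_forall fun x => ?_)
    rw [Real.norm_of_nonneg (div_nonneg (sq_nonneg _) (hwpos x).le)]
    exact hsq x
  refine ⟨hint, (integral_mono hint (hi.const_mul _) hsq).trans ?_⟩
  rw [integral_const_mul]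
  gcongr

/-- The lower bound for `e^{tL} v / v` along the flow. -/
noncomputable def flowLowerConst : ℝ :=
  1 / 2 * Real.exp (-1) * ∫ y, Real.exp (-|y|) ∂(ProbabilityTheory.gaussianReal 0 (1 / 2))

/-- The constant in the weighted upper bound for the semigroup along the flow. -/
noncomputable def flowUpperConst (m : ℕ) : ℝ :=
  2 ^ m * Real.exp 1 * ∫ y, (1 + y ^ 2) ^ m * Real.exp |y|
    ∂(ProbabilityTheory.gaussianReal 0 (1 / 2))

theorem flowLowerConst_pos : 0 < flowLowerConst := by
  have := integral_exp_neg_abs_gaussianReal_pos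
  unfold flowLowerConst
  positivity

theorem flowUpperConst_nonneg (m : ℕ) : 0 ≤ flowUpperConst m :=
  mul_nonneg (by positivity) (integral_nonneg fun y => by positivity)

theorem chiSq_bound_of_relative_bounds {W : ℝ → ℝ} {R t c J L : ℝ} {m : ℕ}
    (hW : ContDiff ℝ 6 W) (hc : ∀ x, R < |x| → W x = c) (ht : 0 < t) (hL : 0 ≤ L)
    (hd : IsOUDensity fun x => Real.exp (W x))
    (h₁ : ∀ x, |t * ouGenerator (fun x => Real.exp (W x)) x| ≤ 1 / 4 * Real.exp (W x))
    (h₂ : ∀ x, |1 / 2 * t ^ 2 * ouGenerator (ouGenerator fun x => Real.exp (W x)) x|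
      ≤ 1 / 4 * Real.exp (W x))
    (h₃ : ∀ x, |ouGenerator (ouGenerator (ouGenerator fun x => Real.exp (W x))) x|
      ≤ L * (1 + x ^ 2) ^ m * Real.exp (W x))
    (hflow : ∀ s, 0 ≤ s → s ≤ t → ∀ x y,
      |W (Real.exp (-s / 2) * x + √(1 - Real.exp (-s)) * y) - W x| ≤ 1 + |y|)
    (hi : Integrable (fun x => (1 + x ^ 2) ^ (2 * m) * Real.exp (W x)) ouMeasure)
    (hiJ : ∫ x, (1 + x ^ 2) ^ (2 * m) * Real.exp (W x) ∂ouMeasure ≤ J) :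
    IsOUDensity (backwardDensity t fun x => Real.exp (W x)) ∧
      (∀ x, 0 < ouSemigroupOne t (backwardDensity t fun x => Real.exp (W x)) x) ∧
      IsOUDensity (ouSemigroupOne t (backwardDensity t fun x => Real.exp (W x))) ∧
      Integrable (fun x =>
        (ouSemigroupOne t (backwardDensity t fun x => Real.exp (W x)) x - Real.exp (W x)) ^ 2
          / ouSemigroupOne t (backwardDensity t fun x => Real.exp (W x)) x) ouMeasure ∧
      ∫ x, (ouSemigroupOne t (backwardDensity t fun x => Real.exp (W x)) x - Real.exp (W x)) ^ 2
          / ouSemigroupOne t (backwardDensity t fun x => Real.exp (W x)) x ∂ouMeasure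
        ≤ (t ^ 3 * (L * flowUpperConst m)) ^ 2 / flowLowerConst * J := by
  have hvc : ContDiff ℝ 6 fun x => Real.exp (W x) := hW.exp
  have hv0 : ∀ x, 0 < Real.exp (W x) := fun x => Real.exp_pos _
  have hvo : ∀ x, R < |x| → Real.exp (W x) = Real.exp c := fun x hx => by rw [hc x hx]
  generalize hv : (fun x => Real.exp (W x)) = v at *
  have hvx : ∀ x, Real.exp (W x) = v x := fun x => congrFun hv x
  simp only [hvx] at h₁ h₂ h₃ hi hiJ hv0 hvo ⊢
  obtain ⟨M, d0, d1, d2⟩ := exists_derivLE_iterate_ouGenerator hvc hvo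
  -- The two corrections are each at most v/4; this is the source of the 1/2 in `flowLowerConst`.
  have hgv : ∀ x, 1 / 2 * Real.exp (W x) ≤ backwardDensity t v x := fun x => by
    rw [hvx, backwardDensity]
    linarith [(abs_le.1 (h₁ x)).2, (abs_le.1 (h₂ x)).1]
  have hgM : ∀ x, |backwardDensity t v x| ≤ 2 * M := fun x => by
    have h1 := abs_le.1 (h₁ x)
    have h2 := abs_le.1 (h₂ x)
    have h3 := (abs_le.1 (d0.bound x)).2
    have := hv0 x
    rw [backwardDensity, abs_le]
    constructor <;> linarith
  have hgc : Continuous (backwardDensity t v) := by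
    have h0 := d0.continuous
    have h1 := d1.continuous
    have h2 := d2.continuous
    unfold backwardDensity
    fun_prop
  have hg0 : ∀ x, 0 ≤ backwardDensity t v x := fun x => le_trans (by positivity) (hgv x)
  have hgd := isOUDensity_backwardDensity hvc hvo hd hg0
  have hlow : ∀ x, flowLowerConst * v x ≤ ouSemigroupOne t (backwardDensity t v) x := fun x => by
    rw [← hvx]
    exact le_ouSemigroupOne_of_le (by norm_num) hgc hgM (hflow t ht.le le_rfl x) hgv
  have hdiff : ∀ x, |ouSemigroupOne t (backwardDensity t v) x - v x|
      ≤ t ^ 3 * (L * flowUpperConst m) * (1 + x ^ 2) ^ m * v x := fun x => by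
    refine (abs_ouSemigroupOne_backwardDensity_sub_le d0 d1 d2 ht (x := x)
      (D := L * flowUpperConst m * (1 + x ^ 2) ^ m * Real.exp (W x))
      fun s hs hst => abs_ouSemigroupOne_le_of_abs_le hL hs.le (hflow s hs.le hst.le x)
        fun z => by rw [hvx]; exact h₃ z).trans_eq ?_
    rw [hvx]; ring
  have hwc : Continuous (ouSemigroupOne t (backwardDensity t v)) :=
    (continuous_ouSemigroupOne_uncurry hgc hgM).comp
      (Continuous.prodMk continuous_const continuous_id)
  exact ⟨hgd, fun x => lt_of_lt_of_le (mul_pos flowLowerConst_pos (hv0 x)) (hlow x),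
    isOUDensity_ouSemigroupOne hgc hgM hgd ht.le,
    integral_sq_sub_div_le flowLowerConst_pos hvc.continuous hwc hv0 hlow hdiff hi hiJ⟩

/-- On |x| ≤ 3R the weight q is at most Q, and Q² is a multiple of R^{8k}, so smallness of tR^{8k}
makes tQ² small. For |x| > 3R the potential is constant and all derivatives vanish. -/
theorem exists_chiSq_bound_backwardDensity (k : ℕ) (hk : 1 ≤ k) {B : ℝ} (hB : 0 ≤ B) :
    ∃ K : ℝ, 0 < K ∧ ∀ (W : ℝ → ℝ) (R t c J : ℝ), ContDiff ℝ 6 W →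
      DerivLE 5 B (fun x => (1 + x ^ 2) ^ (2 * k)) (deriv W) →
      (∀ x, 3 * R < |x| → W x = c) → 1 ≤ R → 0 < t → t * R ^ (8 * k) * K ≤ 1 →
      IsOUDensity (fun x => Real.exp (W x)) →
      Integrable (fun x => (1 + x ^ 2) ^ (24 * k) * Real.exp (W x)) ouMeasure →
      ∫ x, (1 + x ^ 2) ^ (24 * k) * Real.exp (W x) ∂ouMeasure ≤ J →
      IsOUDensity (backwardDensity t fun x => Real.exp (W x)) ∧
      (∀ x, 0 < ouSemigroupOne t (backwardDensity t fun x => Real.exp (W x)) x) ∧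
      IsOUDensity (ouSemigroupOne t (backwardDensity t fun x => Real.exp (W x))) ∧
      Integrable (fun x =>
        (ouSemigroupOne t (backwardDensity t fun x => Real.exp (W x)) x - Real.exp (W x)) ^ 2
          / ouSemigroupOne t (backwardDensity t fun x => Real.exp (W x)) x) ouMeasure ∧
      ∫ x, (ouSemigroupOne t (backwardDensity t fun x => Real.exp (W x)) x - Real.exp (W x)) ^ 2
          / ouSemigroupOne t (backwardDensity t fun x => Real.exp (W x)) x ∂ouMeasure
        ≤ K * t ^ 6 * J := by
  obtain ⟨L, hL, hgen⟩ := exists_ouGenerator_exp_bounds hB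
  have hlc := flowLowerConst_pos
  have huc := flowUpperConst_nonneg (12 * k)
  -- The 10 comes from 1 + (3R)² ≤ 10R² for R ≥ 1.
  set P : ℝ := 10 ^ (4 * k) with hP
  have hP0 : 0 < P := by positivity
  set Z : ℝ := (L * flowUpperConst (12 * k)) ^ 2 / flowLowerConst with hZ
  have hZ0 : 0 ≤ Z := by positivity
  -- The first summand enforces the smallness conditions on tQ²; Z is the constant of the final χ²
  -- bound.
  refine ⟨P * (1 + B + B ^ 2 + 4 * L) + Z, by positivity, ?_⟩
  intro W R t c J hW hdW hc hR ht htR hdens hiJ hJ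
  have hJ0 : 0 ≤ J := le_trans (integral_nonneg fun x => by positivity) hJ
  have hv0 : ∀ x, 0 ≤ Real.exp (W x) := fun x => (Real.exp_pos _).le
  set q : ℝ → ℝ := fun x => (1 + x ^ 2) ^ (2 * k) with hq
  have hq1 : ∀ x, 1 ≤ q x := fun x => one_le_pow₀ (by nlinarith)
  have hq0 : ∀ x, 0 ≤ q x := fun x => zero_le_one.trans (hq1 x)
  have hxq : ∀ x, |x| ≤ q x := fun x => by
    have h1 : |x| ≤ 1 + x ^ 2 := by nlinarith [sq_nonneg (|x| - 1), sq_abs x]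
    exact h1.trans (le_self_pow₀ (by nlinarith) (by omega))
  have hgenW := hgen W q (hW.of_le (by norm_num)) hq1 hxq hdW
  set Q : ℝ := (10 * R ^ 2) ^ (2 * k) with hQ
  have hQ2 : Q ^ 2 = P * R ^ (8 * k) := by
    rw [hQ, hP, ← pow_mul, mul_pow, ← pow_mul]; ring_nf
  have hQ0 : 0 ≤ Q := by positivity
  have hqQ : ∀ x, |x| ≤ 3 * R → q x ≤ Q := fun x hx => by
    refine pow_le_pow_left₀ (by positivity) ?_ _
    have : x ^ 2 ≤ (3 * R) ^ 2 := by rw [← sq_abs]; gcongr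
    nlinarith
  have htQ : t * Q ^ 2 * (1 + B + B ^ 2 + 4 * L) ≤ 1 := by
    refine le_trans ?_ htR
    rw [hQ2]
    have : 0 ≤ t * R ^ (8 * k) * Z := by positivity
    linarith
  obtain ⟨htQ1, htB, htB2, htL⟩ := le_of_mul_one_add_le_one (by positivity) hB hL htQ
  have hdW0 : ∀ x, 3 * R < |x| → deriv W x = 0 := fun x hx =>
    deriv_eq_zero_of_eq_const_outside hc hx
  have hvo : ∀ x, 3 * R < |x| → Real.exp (W x) = Real.exp c := fun x hx => by rw [hc x hx]
  have z1 : ∀ x, 3 * R < |x| → ouGenerator (fun x => Real.exp (W x)) x = 0 := fun x hx =>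
    ouGenerator_eq_zero_of_eq_const_outside hvo hx
  have hmain := chiSq_bound_of_relative_bounds (m := 12 * k) hW hc ht hL hdens
    (fun x => ?_) (fun x => ?_) (fun x => ?_) (fun s hs hst => ?_) (by convert hiJ using 4; ring)
    (by convert hJ using 5; ring)
  · refine ⟨hmain.1, hmain.2.1, hmain.2.2.1, hmain.2.2.2.1, hmain.2.2.2.2.trans ?_⟩
    have : 0 ≤ P * (1 + B + B ^ 2 + 4 * L) := by positivity
    calc (t ^ 3 * (L * flowUpperConst (12 * k))) ^ 2 / flowLowerConst * J
        = Z * t ^ 6 * J := by rw [hZ]; ring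
      _ ≤ _ := by gcongr; linarith
  · rcases le_or_gt |x| (3 * R) with hx | hx
    · rw [abs_mul, abs_of_pos ht]
      calc t * |ouGenerator (fun x => Real.exp (W x)) x|
          ≤ t * (L * Q ^ 2 * Real.exp (W x)) := by
            refine mul_le_mul_of_nonneg_left ((hgenW x).1.trans ?_) ht.le
            have := hqQ x hx
            have := hq0 x
            gcongr
        _ = t * Q ^ 2 * L * Real.exp (W x) := by ring
        _ ≤ _ := mul_le_mul_of_nonneg_right htL (hv0 x)
    · rw [z1 x hx, mul_zero, abs_zero]
      positivity
  · rcases le_or_gt |x| (3 * R) with hx | hx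
    · rw [abs_mul, abs_of_nonneg (by positivity)]
      calc 1 / 2 * t ^ 2 * |ouGenerator (ouGenerator fun x => Real.exp (W x)) x|
          ≤ 1 / 2 * t ^ 2 * (L * Q ^ 4 * Real.exp (W x)) := by
            refine mul_le_mul_of_nonneg_left ((hgenW x).2.1.trans ?_) (by positivity)
            have := hqQ x hx
            have := hq0 x
            gcongr
        _ = 1 / 2 * ((t * Q ^ 2) * (t * Q ^ 2 * L)) * Real.exp (W x) := by ring
        _ ≤ 1 / 2 * (1 * (1 / 4)) * Real.exp (W x) := by gcongr
        _ ≤ _ := by linarith [hv0 x]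
    · rw [ouGenerator_eq_zero_of_eq_const_outside z1 hx, mul_zero, abs_zero]
      positivity
  -- For L³ the weight q⁶ = (1+x²)^{12k} is kept rather than bounded by Q⁶. Its square is integrated
  -- against v, so no power of R is lost in the bound by t⁶.
  · have := (hgenW x).2.2
    rwa [hq, ← pow_mul, show 2 * k * 6 = 12 * k by ring] at this
  · refine abs_sub_le_of_abs_deriv_le (B₁ := B * Q) (B₂ := B * Q ^ 2)
      (hW.differentiable (by norm_num)) (fun x => ?_) (fun x => ?_) hs ?_ ?_
    · rcases le_or_gt |x| (3 * R) with hx | hx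
      · exact (hdW.bound x).trans (mul_le_mul_of_nonneg_left (hqQ x hx) hB)
      · rw [hdW0 x hx, abs_zero]; positivity
    · rcases le_or_gt |x| (3 * R) with hx | hx
      · rw [abs_mul]
        calc |x| * |deriv W x| ≤ Q * (B * Q) :=
              mul_le_mul ((hxq x).trans (hqQ x hx))
                ((hdW.bound x).trans (mul_le_mul_of_nonneg_left (hqQ x hx) hB))
                (abs_nonneg _) hQ0
          _ = _ := by ring
      · rw [hdW0 x hx, mul_zero, abs_zero]; positivity
    · calc s * (B * Q) ^ 2 ≤ t * (B * Q) ^ 2 := by gcongr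
        _ = t * Q ^ 2 * B ^ 2 := by ring
        _ ≤ 1 := htB2
    · calc s * (B * Q ^ 2) ≤ t * (B * Q ^ 2) := by gcongr
        _ = t * Q ^ 2 * B := by ring
        _ ≤ 1 := htB

/-! ### Potentials and their cutoffs -/

theorem PotentialCond.mono {k : ℕ} {C₁ C₂ C₁' C₂' δ : ℝ} {V : ℝ → ℝ}
    (h : PotentialCond k C₁ C₂ δ V) (h₁ : C₁ ≤ C₁') (h₂ : C₂ ≤ C₂') :
    PotentialCond k C₁' C₂' δ V :=
  { h with
    deriv_bound := fun x => (h.deriv_bound x).trans (by gcongr)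
    decay := fun x => (h.decay x).trans (by gcongr) }

namespace PotentialCond

variable {k : ℕ} {C₁ C₂ δ : ℝ} {V : ℝ → ℝ}

theorem abs_iteratedDeriv_le (h : PotentialCond k C₁ C₂ δ V) {j : ℕ} (h1 : 1 ≤ j) (h6 : j ≤ 6)
    (x : ℝ) : |iteratedDeriv j V x| ≤ C₁ * (1 + x ^ 2) ^ k :=
  (Finset.single_le_sum (f := fun j => |iteratedDeriv j V x|) (fun _ _ => abs_nonneg _)
    (Finset.mem_Icc.2 ⟨h1, h6⟩)).trans (h.deriv_bound x)

theorem abs_sub_zero_le (h : PotentialCond k C₁ C₂ δ V) (hC₁ : 0 ≤ C₁) (x : ℝ) :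
    |V x - V 0| ≤ C₁ * (1 + x ^ 2) ^ k * |x| := by
  have := Convex.norm_image_sub_le_of_norm_deriv_le (f := V) (s := Set.Icc (-|x|) |x|)
    (C := C₁ * (1 + x ^ 2) ^ k) (x := 0) (y := x)
    (fun y _ => h.contDiff.differentiable (by norm_num) y) (fun y hy => by
      have h1 := h.abs_iteratedDeriv_le le_rfl (by norm_num) y
      rw [iteratedDeriv_one] at h1
      refine h1.trans ?_
      have : y ^ 2 ≤ x ^ 2 := sq_le_sq.2 (abs_le.2 hy)
      gcongr) (convex_Icc _ _) ⟨by simp, by simp⟩ ⟨neg_abs_le x, le_abs_self x⟩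
  simpa using this

theorem integrable_exp_neg (h : PotentialCond k C₁ C₂ δ V) :
    Integrable (fun x => Real.exp (-V x)) ouMeasure := h.density.2.1

theorem integral_exp_neg (h : PotentialCond k C₁ C₂ δ V) :
    ∫ x, Real.exp (-V x) ∂ouMeasure = 1 := h.density.2.2

theorem integrable_sq_mul_exp_neg (h : PotentialCond k C₁ C₂ δ V) :
    Integrable (fun x => x ^ 2 * Real.exp (-V x)) ouMeasure := by
  by_contra hcon
  have := h.variance
  rw [integral_undef hcon] at this
  norm_num at this

/-- The mass and the variance give ∫ (1 - x²) u dμ = 1/2, and the integrand is nonpositive off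
[-1,1]. Hence u cannot be too small on [-1,1], where V differs from V(0) by at most C₁2^k. -/
theorem apply_zero_le (h : PotentialCond k C₁ C₂ δ V) (hC₁ : 0 ≤ C₁) :
    V 0 ≤ Real.log 4 + C₁ * 2 ^ k := by
  set E := Real.exp (-V 0 + C₁ * 2 ^ k) with hE
  have i1 : Integrable (fun x => Real.exp (-V x) - x ^ 2 * Real.exp (-V x)) ouMeasure :=
    h.integrable_exp_neg.sub h.integrable_sq_mul_exp_neg
  have e1 : ∫ x, (Real.exp (-V x) - x ^ 2 * Real.exp (-V x)) ∂ouMeasure = 1 / 2 := by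
    rw [integral_sub h.integrable_exp_neg h.integrable_sq_mul_exp_neg, h.integral_exp_neg,
      h.variance]
    norm_num
  rw [integral_ouMeasure] at e1
  rw [integrable_ouMeasure_iff] at i1
  have i2 : Integrable ((Set.Icc (-1 : ℝ) 1).indicator fun _ => E) :=
    (integrable_indicator_iff measurableSet_Icc).2 (integrableOn_const (by simp))
  have hle : ∀ x, (Real.exp (-V x) - x ^ 2 * Real.exp (-V x)) * Real.exp (-x ^ 2)
      ≤ (Set.Icc (-1 : ℝ) 1).indicator (fun _ => E) x := fun x => by
    have p1 := Real.exp_pos (-V x)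
    have p2 := Real.exp_pos (-x ^ 2)
    by_cases hx : x ∈ Set.Icc (-1 : ℝ) 1
    · rw [Set.indicator_of_mem hx]
      have hx1 : |x| ≤ 1 := abs_le.2 hx
      have hx2 : x ^ 2 ≤ 1 := by rw [← sq_abs]; exact pow_le_one₀ (abs_nonneg _) hx1
      have h3 : Real.exp (-V x) ≤ E := by
        refine Real.exp_le_exp.2 ?_
        have h4 : C₁ * (1 + x ^ 2) ^ k * |x| ≤ C₁ * 2 ^ k * 1 := by
          gcongr
          linarith
        linarith [(abs_le.1 (h.abs_sub_zero_le hC₁ x)).1]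
      have h5 : Real.exp (-x ^ 2) ≤ 1 := Real.exp_le_one_iff.2 (by nlinarith)
      calc (Real.exp (-V x) - x ^ 2 * Real.exp (-V x)) * Real.exp (-x ^ 2)
          ≤ Real.exp (-V x) * 1 := by
            refine mul_le_mul ?_ h5 p2.le p1.le
            nlinarith [sq_nonneg x]
        _ ≤ E := by linarith
    · rw [Set.indicator_of_notMem hx]
      have hx1 : 1 < |x| := by
        by_contra hcon
        exact hx (abs_le.1 (not_lt.1 hcon))
      have hx2 : 1 ≤ x ^ 2 := by rw [← sq_abs]; exact one_le_pow₀ hx1.le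
      refine mul_nonpos_of_nonpos_of_nonneg ?_ p2.le
      nlinarith
  have hint := integral_mono i1 i2 hle
  rw [e1, integral_indicator measurableSet_Icc, setIntegral_const] at hint
  simp only [measureReal_def, Real.volume_Icc, smul_eq_mul] at hint
  rw [ENNReal.toReal_ofReal (by norm_num)] at hint
  have h6 : Real.exp (V 0) ≤ Real.exp (Real.log 4 + C₁ * 2 ^ k) := by
    rw [Real.exp_add, Real.exp_log (by norm_num)]
    rw [hE, Real.exp_add, Real.exp_neg] at hint
    have p0 := Real.exp_pos (V 0)
    have : 1 / 2 * Real.exp (V 0) ≤ 2 * Real.exp (C₁ * 2 ^ k) := by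
      calc 1 / 2 * Real.exp (V 0)
          ≤ (1 - -1) * ((Real.exp (V 0))⁻¹ * Real.exp (C₁ * 2 ^ k)) * Real.exp (V 0) := by gcongr
        _ = _ := by field_simp; ring
    linarith
  exact Real.exp_le_exp.1 h6

theorem neg_log_le_apply_zero (h : PotentialCond k C₁ C₂ δ V) (hC₂ : 0 < C₂) :
    -Real.log C₂ ≤ V 0 := by
  have := h.decay 0
  simp only [ne_eq, OfNat.ofNat_ne_zero, not_false_eq_true, zero_pow, neg_zero, Real.exp_zero,
    mul_one, mul_zero] at this
  have := (Real.le_log_iff_exp_le hC₂).2 this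
  linarith

end PotentialCond

/-- Derivatives falling on the cutoff leave V itself, which is recovered from V(0) and V' at the
price of a factor |x|. As k + 1 ≤ 2k, the weight with exponent 2k covers this. -/
theorem exists_derivLE_cutoff {k : ℕ} (hk : 1 ≤ k) {C₁ C₂ δ : ℝ} (hC₁ : 0 ≤ C₁) (hC₂ : 1 ≤ C₂)
    {θ : ℝ → ℝ} (hθ : IsSmoothCutoff θ) :
    ∃ B : ℝ, 0 ≤ B ∧ ∀ V : ℝ → ℝ, PotentialCond k C₁ C₂ δ V → ∀ R a : ℝ, 1 ≤ R →
      DerivLE 6 B (fun x => (1 + x ^ 2) ^ (2 * k)) (fun x => V x * θ ((x - a) / R)) := by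
  have hs : HasCompactSupport θ := by
    refine HasCompactSupport.intro (isCompact_Icc (a := -2) (b := 2)) fun x hx => hθ.eq_zero x ?_
    by_contra hcon
    exact hx (abs_le.1 (not_le.1 hcon).le)
  obtain ⟨M, hM, hθM⟩ := DerivLE.exists_of_hasCompactSupport (r := 6)
    (contDiff_infty.1 hθ.contDiff 6) hs
  have hlog : 0 ≤ Real.log C₂ := Real.log_nonneg hC₂
  have hlog4 : 0 ≤ Real.log 4 := Real.log_nonneg (by norm_num)
  set A := Real.log C₂ + Real.log 4 + C₁ * 2 ^ k with hA
  have hA0 : 0 ≤ A := by positivity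
  refine ⟨2 ^ 6 * ((A + C₁) * M), by positivity, fun V hV R a hR => ?_⟩
  have hV0 : |V 0| ≤ A := abs_le.2
    ⟨by linarith [hV.neg_log_le_apply_zero (by linarith), mul_nonneg hC₁ (pow_nonneg zero_le_two k)],
      by linarith [hV.apply_zero_le hC₁]⟩
  have hVd : DerivLE 6 (A + C₁) (fun x => (1 + x ^ 2) ^ (2 * k)) V := by
    refine DerivLE.of_iteratedDeriv (by exact_mod_cast hV.contDiff) fun i hi x => ?_
    have hq : (1 : ℝ) ≤ 1 + x ^ 2 := by nlinarith
    rcases Nat.eq_zero_or_pos i with rfl | h1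
    · rw [iteratedDeriv_zero]
      have h1 : |x| ≤ 1 + x ^ 2 := by nlinarith [sq_nonneg (|x| - 1), sq_abs x]
      have h2 := hV.abs_sub_zero_le hC₁ x
      have h3 : (1 + x ^ 2) ^ k * |x| ≤ (1 + x ^ 2) ^ (2 * k) := by
        calc (1 + x ^ 2) ^ k * |x| ≤ (1 + x ^ 2) ^ k * (1 + x ^ 2) := by gcongr
          _ = (1 + x ^ 2) ^ (k + 1) := (pow_succ _ _).symm
          _ ≤ _ := pow_le_pow_right₀ hq (by omega)
      have h4 : (1 : ℝ) ≤ (1 + x ^ 2) ^ (2 * k) := one_le_pow₀ hq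
      calc |V x| = |(V x - V 0) + V 0| := by ring_nf
        _ ≤ |V x - V 0| + |V 0| := abs_add_le _ _
        _ ≤ C₁ * ((1 + x ^ 2) ^ k * |x|) + A * 1 := by rw [mul_one, ← mul_assoc]; gcongr
        _ ≤ C₁ * (1 + x ^ 2) ^ (2 * k) + A * (1 + x ^ 2) ^ (2 * k) := by gcongr
        _ = _ := by ring
    · refine (hV.abs_iteratedDeriv_le h1 hi x).trans ?_
      have : (1 + x ^ 2) ^ k ≤ (1 + x ^ 2) ^ (2 * k) := pow_le_pow_right₀ hq (by omega)
      gcongr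
      linarith
  have := hVd.mul (hθM.comp_affine (a := a) hR hM)
  simpa using this

/-! ### Normalisation and tail estimates for the cutoff density -/

theorem exp_neg_mul_le_one_add {V θ : ℝ} (h0 : 0 ≤ θ) (h1 : θ ≤ 1) :
    Real.exp (-(V * θ)) ≤ 1 + Real.exp (-V) := by
  rcases le_or_gt 0 V with hV | hV
  · have : Real.exp (-(V * θ)) ≤ 1 := Real.exp_le_one_iff.2 (by nlinarith)
    linarith [Real.exp_pos (-V)]
  · have : Real.exp (-(V * θ)) ≤ Real.exp (-V) := Real.exp_le_exp.2 (by nlinarith)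
    linarith

theorem one_add_exp_neg_mul_exp_le {k : ℕ} {C₁ C₂ δ : ℝ} {V : ℝ → ℝ} (hC₂ : 1 ≤ C₂)
    (hV : PotentialCond k C₁ C₂ δ V) (x : ℝ) :
    (1 + Real.exp (-V x)) * Real.exp (-x ^ 2) ≤ 2 * C₂ * Real.exp (-min δ 1 * x ^ 2) := by
  have h1 : Real.exp (-x ^ 2) ≤ Real.exp (-min δ 1 * x ^ 2) :=
    Real.exp_le_exp.2 (by nlinarith [sq_nonneg x, min_le_right δ 1])
  have h2 : Real.exp (-δ * x ^ 2) ≤ Real.exp (-min δ 1 * x ^ 2) :=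
    Real.exp_le_exp.2 (by nlinarith [sq_nonneg x, min_le_left δ 1])
  have h3 := hV.decay x
  have p := Real.exp_pos (-min δ 1 * x ^ 2)
  have h4 : C₂ * Real.exp (-δ * x ^ 2) ≤ C₂ * Real.exp (-min δ 1 * x ^ 2) := by gcongr
  nlinarith

theorem isOUDensity_cutoffDensity_iff {V θ : ℝ → ℝ} {R a d : ℝ}
    (hi : Integrable (fun x => Real.exp (-(V x * θ ((x - a) / R)))) ouMeasure) :
    IsOUDensity (cutoffDensity V θ R a d) ↔
      Real.exp (-d) * ∫ x, Real.exp (-(V x * θ ((x - a) / R))) ∂ouMeasure = 1 := by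
  have e : cutoffDensity V θ R a d
      = fun x => Real.exp (-d) * Real.exp (-(V x * θ ((x - a) / R))) := by
    ext x
    rw [cutoffDensity, ← Real.exp_add]
    ring_nf
  unfold IsOUDensity
  rw [e]
  constructor
  · rintro ⟨-, -, h⟩
    rwa [integral_const_mul] at h
  · intro h
    exact ⟨fun x => by positivity, hi.const_mul _, by rwa [integral_const_mul]⟩

theorem existsUnique_exp_neg_mul_eq_one {I : ℝ} (hI : 0 < I) : ∃! d : ℝ, Real.exp (-d) * I = 1 := by
  refine ⟨Real.log I, ?_, fun d hd => ?_⟩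
  · simp only
    rw [Real.exp_neg, Real.exp_log hI]; field_simp
  · have : I = Real.exp d := by
      have h : Real.exp (-d) * I = 1 := hd
      rw [Real.exp_neg] at h
      field_simp at h
      exact h
    rw [this, Real.log_exp]

/-- The difference vanishes for |x| ≤ (1-κ)R, where |x-a| ≤ R. Beyond that, half of the Gaussian
rate pays for the factor in R and the other half for integrability. The weight 1+x² serves the L¹
distance and the mean at once. -/
theorem integral_weighted_cutoff_sub_le {k : ℕ} {C₁ C₂ δ κ : ℝ} (hC₂ : 1 ≤ C₂) (hδ : 0 < δ)
    (hκ : κ < 1) {θ : ℝ → ℝ} (hθ : IsSmoothCutoff θ) {V : ℝ → ℝ}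
    (hV : PotentialCond k C₁ C₂ δ V) {R a : ℝ} (hR : 1 ≤ R) (ha : |a| ≤ κ * R) :
    Integrable (fun x => (1 + x ^ 2) *
        |Real.exp (-(V x * θ ((x - a) / R))) - Real.exp (-V x)|) ouMeasure ∧
      ∫ x, (1 + x ^ 2) * |Real.exp (-(V x * θ ((x - a) / R))) - Real.exp (-V x)| ∂ouMeasure
        ≤ (2 * C₂ * ∫ x : ℝ, (1 + x ^ 2) ^ 1 * Real.exp (-(min δ 1 / 2) * x ^ 2))
          * Real.exp (-(min δ 1 / 2 * (1 - κ) ^ 2) * R ^ 2) := by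
  set η := min δ 1 with hη
  have hη0 : 0 < η := lt_min hδ one_pos
  have hcV : Continuous V := hV.contDiff.continuous
  have hcθ : Continuous θ := hθ.contDiff.continuous
  have hpt : ∀ x, (1 + x ^ 2) * |Real.exp (-(V x * θ ((x - a) / R))) - Real.exp (-V x)|
      * Real.exp (-x ^ 2) ≤ 2 * C₂ * Real.exp (-(η / 2 * (1 - κ) ^ 2) * R ^ 2)
        * ((1 + x ^ 2) ^ 1 * Real.exp (-(η / 2) * x ^ 2)) := fun x => by
    rcases le_or_gt |x| ((1 - κ) * R) with hx | hx
    · have : |(x - a) / R| ≤ 1 := by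
        rw [abs_div, abs_of_pos (by linarith : 0 < R), div_le_one (by linarith)]
        calc |x - a| ≤ |x| + |a| := abs_sub _ _
          _ ≤ _ := by linarith
      rw [hθ.eq_one _ this, mul_one, sub_self, abs_zero, mul_zero, zero_mul]
      positivity
    · have h1 : |Real.exp (-(V x * θ ((x - a) / R))) - Real.exp (-V x)| ≤ 1 + Real.exp (-V x) := by
        have := exp_neg_mul_le_one_add (V := V x) (hθ.nonneg ((x - a) / R)) (hθ.le_one _)
        have := Real.exp_pos (-(V x * θ ((x - a) / R)))
        have := Real.exp_pos (-V x)
        rw [abs_le]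
        constructor <;> linarith
      have h2 := one_add_exp_neg_mul_exp_le hC₂ hV x
      have h3 : ((1 - κ) * R) ^ 2 ≤ x ^ 2 := by
        rw [← sq_abs x]
        exact pow_le_pow_left₀ (mul_nonneg (by linarith) (by linarith)) hx.le 2
      have h4 : Real.exp (-η * x ^ 2)
          ≤ Real.exp (-(η / 2 * (1 - κ) ^ 2) * R ^ 2) * Real.exp (-(η / 2) * x ^ 2) := by
        rw [← Real.exp_add]
        exact Real.exp_le_exp.2 (by nlinarith)
      calc (1 + x ^ 2) * |Real.exp (-(V x * θ ((x - a) / R))) - Real.exp (-V x)|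
            * Real.exp (-x ^ 2)
          ≤ (1 + x ^ 2) * (1 + Real.exp (-V x)) * Real.exp (-x ^ 2) := by gcongr
        _ = (1 + x ^ 2) * ((1 + Real.exp (-V x)) * Real.exp (-x ^ 2)) := by ring
        _ ≤ (1 + x ^ 2) * (2 * C₂ * (Real.exp (-(η / 2 * (1 - κ) ^ 2) * R ^ 2)
            * Real.exp (-(η / 2) * x ^ 2))) := by
          refine mul_le_mul_of_nonneg_left (h2.trans ?_) (by positivity)
          exact mul_le_mul_of_nonneg_left h4 (by positivity)
        _ = _ := by ring
  have hdom := (integrable_one_add_sq_pow_mul_exp (half_pos hη0) 1).const_mul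
    (2 * C₂ * Real.exp (-(η / 2 * (1 - κ) ^ 2) * R ^ 2))
  have hint : Integrable (fun x => (1 + x ^ 2) *
      |Real.exp (-(V x * θ ((x - a) / R))) - Real.exp (-V x)| * Real.exp (-x ^ 2)) := by
    refine hdom.mono' (by fun_prop) (Filter.Eventually.of_forall fun x => ?_)
    rw [Real.norm_of_nonneg (by positivity)]
    exact hpt x
  refine ⟨integrable_ouMeasure_iff.2 hint, ?_⟩
  rw [integral_ouMeasure]
  refine (integral_mono hint hdom hpt).trans_eq ?_
  rw [integral_const_mul]
  ring

theorem integrable_weighted_cutoff {k : ℕ} {C₁ C₂ δ : ℝ} (hC₂ : 1 ≤ C₂) (hδ : 0 < δ)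
    {θ : ℝ → ℝ} (hθ : IsSmoothCutoff θ) {V : ℝ → ℝ} (hV : PotentialCond k C₁ C₂ δ V) (m : ℕ)
    (R a : ℝ) :
    Integrable (fun x => (1 + x ^ 2) ^ m * Real.exp (-(V x * θ ((x - a) / R)))) ouMeasure ∧
      ∫ x, (1 + x ^ 2) ^ m * Real.exp (-(V x * θ ((x - a) / R))) ∂ouMeasure
        ≤ 2 * C₂ * ∫ x : ℝ, (1 + x ^ 2) ^ m * Real.exp (-min δ 1 * x ^ 2) := by
  have hcV : Continuous V := hV.contDiff.continuous
  have hcθ : Continuous θ := hθ.contDiff.continuous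
  have hpt : ∀ x, (1 + x ^ 2) ^ m * Real.exp (-(V x * θ ((x - a) / R))) * Real.exp (-x ^ 2)
      ≤ 2 * C₂ * ((1 + x ^ 2) ^ m * Real.exp (-min δ 1 * x ^ 2)) := fun x => by
    calc (1 + x ^ 2) ^ m * Real.exp (-(V x * θ ((x - a) / R))) * Real.exp (-x ^ 2)
        ≤ (1 + x ^ 2) ^ m * (1 + Real.exp (-V x)) * Real.exp (-x ^ 2) := by
          gcongr
          exact exp_neg_mul_le_one_add (hθ.nonneg _) (hθ.le_one _)
      _ = (1 + x ^ 2) ^ m * ((1 + Real.exp (-V x)) * Real.exp (-x ^ 2)) := by ring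
      _ ≤ (1 + x ^ 2) ^ m * (2 * C₂ * Real.exp (-min δ 1 * x ^ 2)) := by
          exact mul_le_mul_of_nonneg_left (one_add_exp_neg_mul_exp_le hC₂ hV x) (by positivity)
      _ = _ := by ring
  have hdom := (integrable_one_add_sq_pow_mul_exp (lt_min hδ one_pos) m).const_mul (2 * C₂)
  have hint : Integrable (fun x => (1 + x ^ 2) ^ m * Real.exp (-(V x * θ ((x - a) / R)))
      * Real.exp (-x ^ 2)) := by
    refine hdom.mono' (by fun_prop) (Filter.Eventually.of_forall fun x => ?_)
    rw [Real.norm_of_nonneg (by positivity)]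
    exact hpt x
  refine ⟨integrable_ouMeasure_iff.2 hint, ?_⟩
  rw [integral_ouMeasure]
  exact (integral_mono hint hdom hpt).trans_eq (integral_const_mul _ _)

theorem exists_cutoffDensity_bounds {C₂ δ κ : ℝ} (hC₂ : 1 ≤ C₂) (hδ : 0 < δ) (hκ : κ < 1)
    (m : ℕ) :
    ∃ T η J : ℝ, 0 ≤ T ∧ 0 < η ∧ ∀ (k : ℕ) (C₁ : ℝ) (θ V : ℝ → ℝ) (R a : ℝ),
      IsSmoothCutoff θ → PotentialCond k C₁ C₂ δ V → 1 ≤ R → |a| ≤ κ * R →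
      T * Real.exp (-η * R ^ 2) ≤ 1 / 2 →
      (∃! d : ℝ, IsOUDensity (cutoffDensity V θ R a d)) ∧
      ∀ d : ℝ, IsOUDensity (cutoffDensity V θ R a d) →
        Integrable (fun x => (1 + x ^ 2) * |cutoffDensity V θ R a d x - Real.exp (-V x)|)
          ouMeasure ∧
        ∫ x, (1 + x ^ 2) * |cutoffDensity V θ R a d x - Real.exp (-V x)| ∂ouMeasure
          ≤ 5 * (T * Real.exp (-η * R ^ 2)) ∧
        Integrable (fun x => (1 + x ^ 2) ^ m * cutoffDensity V θ R a d x) ouMeasure ∧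
        ∫ x, (1 + x ^ 2) ^ m * cutoffDensity V θ R a d x ∂ouMeasure ≤ J := by
  have hη0 : 0 < min δ 1 := lt_min hδ one_pos
  refine ⟨2 * C₂ * ∫ x : ℝ, (1 + x ^ 2) ^ 1 * Real.exp (-(min δ 1 / 2) * x ^ 2),
    min δ 1 / 2 * (1 - κ) ^ 2,
    2 * (2 * C₂ * ∫ x : ℝ, (1 + x ^ 2) ^ m * Real.exp (-min δ 1 * x ^ 2)),
    mul_nonneg (by linarith) (integral_nonneg fun x => by positivity), ?_, ?_⟩
  · have : 0 < 1 - κ := by linarith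
    positivity
  intro k C₁ θ V R a hθ hV hR ha hT
  obtain ⟨i1, b1⟩ := integral_weighted_cutoff_sub_le hC₂ hδ hκ hθ hV hR ha
  set τ := (2 * C₂ * ∫ x : ℝ, (1 + x ^ 2) ^ 1 * Real.exp (-(min δ 1 / 2) * x ^ 2))
    * Real.exp (-(min δ 1 / 2 * (1 - κ) ^ 2) * R ^ 2) with hτ
  obtain ⟨im, bm⟩ := integrable_weighted_cutoff hC₂ hδ hθ hV m R a
  have i0 : Integrable (fun x => Real.exp (-(V x * θ ((x - a) / R)))) ouMeasure := by
    have := (integrable_weighted_cutoff hC₂ hδ hθ hV 0 R a).1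
    simpa using this
  set I := ∫ x, Real.exp (-(V x * θ ((x - a) / R))) ∂ouMeasure with hI
  have hI1 : |I - 1| ≤ τ := by
    rw [← hV.integral_exp_neg, hI, ← integral_sub i0 hV.integrable_exp_neg]
    refine (abs_integral_le_integral_abs).trans (le_trans ?_ b1)
    refine integral_mono (i0.sub hV.integrable_exp_neg).abs i1 fun x => ?_
    exact le_mul_of_one_le_left (abs_nonneg _) (by nlinarith)
  have hIlow : 1 / 2 ≤ I := by linarith [(abs_le.1 hI1).1]
  have hI0 : 0 < I := by linarith
  refine ⟨by simpa only [isOUDensity_cutoffDensity_iff i0] using existsUnique_exp_neg_mul_eq_one hI0,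
    fun d hd => ?_⟩
  rw [isOUDensity_cutoffDensity_iff i0, ← hI] at hd
  -- Since e^{-d} I = 1 with I ≥ 1/2.
  have hed : Real.exp (-d) ≤ 2 := by nlinarith [Real.exp_pos (-d)]
  have hed1 : |Real.exp (-d) - 1| ≤ 2 * τ := by
    have : Real.exp (-d) - 1 = Real.exp (-d) * (-(I - 1)) := by linear_combination hd
    rw [this, abs_mul, abs_neg, Real.abs_exp]
    gcongr
  have e : ∀ x, cutoffDensity V θ R a d x
      = Real.exp (-d) * Real.exp (-(V x * θ ((x - a) / R))) := fun x => by
    rw [cutoffDensity, ← Real.exp_add]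
    ring_nf
  have hpt : ∀ x, (1 + x ^ 2) * |cutoffDensity V θ R a d x - Real.exp (-V x)|
      ≤ 2 * ((1 + x ^ 2) * |Real.exp (-(V x * θ ((x - a) / R))) - Real.exp (-V x)|)
        + 2 * τ * Real.exp (-V x) + 2 * τ * (x ^ 2 * Real.exp (-V x)) := fun x => by
    have h1 : cutoffDensity V θ R a d x - Real.exp (-V x)
        = Real.exp (-d) * (Real.exp (-(V x * θ ((x - a) / R))) - Real.exp (-V x))
          + (Real.exp (-d) - 1) * Real.exp (-V x) := by rw [e]; ring
    have h2 : |cutoffDensity V θ R a d x - Real.exp (-V x)|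
        ≤ 2 * |Real.exp (-(V x * θ ((x - a) / R))) - Real.exp (-V x)|
          + 2 * τ * Real.exp (-V x) := by
      rw [h1]
      refine (abs_add_le _ _).trans ?_
      rw [abs_mul, abs_mul, Real.abs_exp, Real.abs_exp]
      gcongr
    calc _ ≤ (1 + x ^ 2) * (2 * |Real.exp (-(V x * θ ((x - a) / R))) - Real.exp (-V x)|
          + 2 * τ * Real.exp (-V x)) := by gcongr
      _ = _ := by ring
  have hdom : Integrable (fun x =>
      2 * ((1 + x ^ 2) * |Real.exp (-(V x * θ ((x - a) / R))) - Real.exp (-V x)|)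
        + 2 * τ * Real.exp (-V x) + 2 * τ * (x ^ 2 * Real.exp (-V x))) ouMeasure :=
    ((i1.const_mul _).add (hV.integrable_exp_neg.const_mul _)).add
      (hV.integrable_sq_mul_exp_neg.const_mul _)
  have hcV : Continuous V := hV.contDiff.continuous
  have hcθ : Continuous θ := hθ.contDiff.continuous
  have hint : Integrable (fun x => (1 + x ^ 2) *
      |cutoffDensity V θ R a d x - Real.exp (-V x)|) ouMeasure := by
    refine hdom.mono' ?_ (Filter.Eventually.of_forall fun x => ?_)
    · unfold cutoffDensity
      fun_prop
    · rw [Real.norm_of_nonneg (by positivity)]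
      exact hpt x
  refine ⟨hint, ?_, ?_, ?_⟩
  -- The three terms contribute 2τ, 2τ and, by the variance 1/2, τ: hence the factor 5.
  · refine (integral_mono hint hdom hpt).trans ?_
    rw [integral_linear_combination₃ i1 hV.integrable_exp_neg hV.integrable_sq_mul_exp_neg,
      hV.integral_exp_neg, hV.variance]
    linarith
  · refine (im.const_mul (Real.exp (-d))).congr (Filter.Eventually.of_forall fun x => ?_)
    simp only [e]
    ring
  · have : ∫ x, (1 + x ^ 2) ^ m * cutoffDensity V θ R a d x ∂ouMeasure
        = Real.exp (-d) * ∫ x, (1 + x ^ 2) ^ m * Real.exp (-(V x * θ ((x - a) / R)))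
          ∂ouMeasure := by
      rw [← integral_const_mul]
      refine integral_congr_ae (Filter.Eventually.of_forall fun x => ?_)
      simp only [e]
      ring
    rw [this]
    have h0 : 0 ≤ ∫ x, (1 + x ^ 2) ^ m * Real.exp (-(V x * θ ((x - a) / R))) ∂ouMeasure :=
      integral_nonneg fun x => by positivity
    gcongr

/-! ### Asymptotics in `N` and the main result -/

theorem eventually_rpow_mul_le_one {p : ℝ} (hp : p < 0) (K : ℝ) :
    ∀ᶠ N : ℕ in Filter.atTop, (N : ℝ) ^ p * K ≤ 1 := by
  have h1 := ((tendsto_rpow_neg_atTop (neg_pos.2 hp)).comp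
    (tendsto_natCast_atTop_atTop (R := ℝ))).mul_const K
  rw [zero_mul] at h1
  filter_upwards [h1.eventually_le_const one_pos] with N hN
  simpa using hN

theorem eventually_sq_mul_exp_le {c η : ℝ} (hc : 0 < c) (hη : 0 < η) (T : ℝ) :
    ∀ᶠ N : ℕ in Filter.atTop, (N : ℝ) ^ 2 * (T * Real.exp (-η * ((N : ℝ) ^ c) ^ 2))
      ≤ Real.exp (-c * (N : ℝ) ^ c) := by
  have hR : Filter.Tendsto (fun N : ℕ => (N : ℝ) ^ c) Filter.atTop Filter.atTop :=
    (tendsto_rpow_atTop hc).comp tendsto_natCast_atTop_atTop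
  have h1 := ((tendsto_rpow_mul_exp_neg_mul_atTop_nhds_zero (2 / c) 1 one_pos).comp hR).mul_const |T|
  rw [zero_mul] at h1
  -- With y = N^c ≥ (c+1)/η one has ηy² ≥ y + cy. The factor e^{-y} absorbs N²|T| = y^{2/c}|T|, and
  -- e^{-cy} is left.
  filter_upwards [h1.eventually_le_const one_pos, hR.eventually_ge_atTop ((c + 1) / η)] with N h2 h3
  set y := (N : ℝ) ^ c with hy
  have hy0 : 0 ≤ y := by positivity
  have hN2 : y ^ (2 / c) = (N : ℝ) ^ 2 := by
    rw [hy, ← Real.rpow_mul (by positivity), mul_div_cancel₀ _ hc.ne', Real.rpow_two]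
  simp only [Function.comp_apply, ← hy, hN2] at h2
  rw [div_le_iff₀ hη] at h3
  have h4 : Real.exp (-η * y ^ 2) ≤ Real.exp (-1 * y) * Real.exp (-c * y) := by
    rw [← Real.exp_add]
    exact Real.exp_le_exp.2 (by nlinarith)
  calc (N : ℝ) ^ 2 * (T * Real.exp (-η * y ^ 2))
      ≤ (N : ℝ) ^ 2 * (|T| * (Real.exp (-1 * y) * Real.exp (-c * y))) := by
        gcongr
        exact le_abs_self T
    _ = ((N : ℝ) ^ 2 * Real.exp (-1 * y) * |T|) * Real.exp (-c * y) := by ring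
    _ ≤ 1 * Real.exp (-c * y) := by gcongr
    _ = _ := one_mul _

theorem deriv_add_const_neg (f : ℝ → ℝ) (d : ℝ) :
    (deriv fun x => -(f x + d)) = deriv fun x => -f x := by
  ext x
  simp only [neg_add]
  exact deriv_add_const (f := fun x => -f x) (-d)

/-- All the one-dimensional estimates for the cutoff density. -/
theorem exists_oneDim_bounds {k : ℕ} (hk : 1 ≤ k) {θ : ℝ → ℝ} (hθ : IsSmoothCutoff θ) (C₁ C₂ : ℝ)
    {δ κ : ℝ} (hδ : 0 < δ) (hκ : κ < 1) :
    ∃ T η K : ℝ, 0 ≤ T ∧ 0 < η ∧ 0 < K ∧ ∀ (V : ℝ → ℝ) (R a : ℝ),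
      PotentialCond k C₁ C₂ δ V → 1 ≤ R → |a| ≤ κ * R → T * Real.exp (-η * R ^ 2) ≤ 1 / 2 →
      (∃! d : ℝ, IsOUDensity (cutoffDensity V θ R a d)) ∧
      ∀ (d : ℝ) (v : ℝ → ℝ), v = cutoffDensity V θ R a d → IsOUDensity v →
        Continuous v ∧
        Integrable (fun x => (1 + x ^ 2) * |v x - Real.exp (-V x)|) ouMeasure ∧
        ∫ x, (1 + x ^ 2) * |v x - Real.exp (-V x)| ∂ouMeasure ≤ T * Real.exp (-η * R ^ 2) ∧
        ∀ t : ℝ, 0 < t → t * R ^ (8 * k) * K ≤ 1 →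
          IsOUDensity (backwardDensity t v) ∧
          (∀ x, 0 < ouSemigroupOne t (backwardDensity t v) x) ∧
          IsOUDensity (ouSemigroupOne t (backwardDensity t v)) ∧
          Integrable (fun x => (ouSemigroupOne t (backwardDensity t v) x - v x) ^ 2
            / ouSemigroupOne t (backwardDensity t v) x) ouMeasure ∧
          ∫ x, (ouSemigroupOne t (backwardDensity t v) x - v x) ^ 2
            / ouSemigroupOne t (backwardDensity t v) x ∂ouMeasure ≤ K * t ^ 6 := by
  have hC₂ : 1 ≤ |C₂| + 1 := by linarith [abs_nonneg C₂]
  obtain ⟨B, hB, hcut⟩ := exists_derivLE_cutoff hk (δ := δ) (abs_nonneg C₁) hC₂ hθ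
  obtain ⟨K, hK, hchi⟩ := exists_chiSq_bound_backwardDensity k hk hB
  obtain ⟨T, η, J, hT, hη, hdens⟩ := exists_cutoffDensity_bounds hC₂ hδ hκ (24 * k)
  -- One constant must be at least K for the smallness condition and at least KJ for the χ² bound.
  refine ⟨5 * T, η, K * (1 + |J|), by positivity, hη, by positivity, ?_⟩
  intro V R a hV hR ha htail
  replace hV := hV.mono (le_abs_self C₁)
    ((le_abs_self C₂).trans (le_add_of_nonneg_right zero_le_one))
  have htail0 : 0 ≤ T * Real.exp (-η * R ^ 2) := by positivity
  obtain ⟨huniq, hall⟩ := hdens k |C₁| θ V R a hθ hV hR ha (by linarith)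
  refine ⟨huniq, ?_⟩
  rintro d v rfl hd
  obtain ⟨iw, bw, iJ, bJ⟩ := hall d hd
  have hcV : Continuous V := hV.contDiff.continuous
  have hcθ : Continuous θ := hθ.contDiff.continuous
  have hcont : ContDiff ℝ 6 fun x => -(V x * θ ((x - a) / R) + d) := by
    have h6 : ContDiff ℝ 6 θ := contDiff_infty.1 hθ.contDiff 6
    have hV6 := hV.contDiff
    have h6' : ContDiff ℝ 6 fun x => θ ((x - a) / R) := h6.comp (by fun_prop)
    fun_prop
  have hderiv : DerivLE 5 B (fun x => (1 + x ^ 2) ^ (2 * k))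
      (deriv fun x => -(V x * θ ((x - a) / R) + d)) := by
    rw [deriv_add_const_neg]
    exact (hcut V hV R a hR).neg.deriv
  -- Because |a| ≤ R, the condition |x| > 3R forces |x-a| ≥ 2R, where the cutoff vanishes.
  have hout : ∀ x, 3 * R < |x| → -(V x * θ ((x - a) / R) + d) = -d := fun x hx => by
    have haR : |a| ≤ R := ha.trans (mul_le_of_le_one_left (by linarith) hκ.le)
    have h1 : |x| ≤ |x - a| + |a| := by simpa using abs_add_le (x - a) a
    rw [hθ.eq_zero, mul_zero, zero_add]
    rw [abs_div, abs_of_pos (by linarith : 0 < R), le_div_iff₀ (by linarith)]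
    linarith
  refine ⟨hcont.continuous.rexp, iw, by linarith, fun t ht htR => ?_⟩
  have hR8 : 0 ≤ t * R ^ (8 * k) := by positivity
  obtain ⟨h1, h2, h3, h4, h5⟩ := hchi (fun x => -(V x * θ ((x - a) / R) + d)) R t (-d) J
    hcont hderiv hout hR ht ((mul_le_mul_of_nonneg_left
      (le_mul_of_one_le_right hK.le (by linarith [abs_nonneg J])) hR8).trans htR) hd iJ bJ
  refine ⟨h1, h2, h3, h4, h5.trans ?_⟩
  calc K * t ^ 6 * J ≤ K * t ^ 6 * (1 + |J|) := by
        gcongr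
        linarith [le_abs_self J]
    _ = _ := by ring

/-- As u is centred, the mean of v is ∫ x(v-u) dμ, and |x| ≤ 1+x². -/
theorem abs_integral_id_mul_le {k : ℕ} {C₁ C₂ δ : ℝ} {V v : ℝ → ℝ}
    (hV : PotentialCond k C₁ C₂ δ V) (hv : Continuous v)
    (hi : Integrable (fun x => (1 + x ^ 2) * |v x - Real.exp (-V x)|) ouMeasure) :
    Integrable (fun x => x * v x) ouMeasure ∧
      |∫ x, x * v x ∂ouMeasure|
        ≤ ∫ x, (1 + x ^ 2) * |v x - Real.exp (-V x)| ∂ouMeasure := by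
  have hcV : Continuous V := hV.contDiff.continuous
  have habs : ∀ x : ℝ, |x| ≤ 1 + x ^ 2 := fun x => by nlinarith [sq_nonneg (|x| - 1), sq_abs x]
  have ixd : Integrable (fun x => x * (v x - Real.exp (-V x))) ouMeasure := by
    refine hi.mono' (by fun_prop) (Filter.Eventually.of_forall fun x => ?_)
    rw [Real.norm_eq_abs, abs_mul]
    exact mul_le_mul_of_nonneg_right (habs x) (abs_nonneg _)
  have ixu : Integrable (fun x => x * Real.exp (-V x)) ouMeasure := by
    refine (hV.integrable_exp_neg.add hV.integrable_sq_mul_exp_neg).mono' (by fun_prop)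
      (Filter.Eventually.of_forall fun x => ?_)
    rw [Real.norm_eq_abs, abs_mul, Real.abs_exp]
    calc |x| * Real.exp (-V x) ≤ (1 + x ^ 2) * Real.exp (-V x) :=
          mul_le_mul_of_nonneg_right (habs x) (Real.exp_pos _).le
      _ = _ := by simp only [Pi.add_apply]; ring
  have hxv : (fun x => x * v x)
      = fun x => x * (v x - Real.exp (-V x)) + x * Real.exp (-V x) := by
    ext x; ring
  refine ⟨by rw [hxv]; exact ixd.add ixu, ?_⟩
  rw [hxv, integral_add ixd ixu, hV.mean, add_zero]
  refine abs_integral_le_integral_abs.trans (integral_mono ixd.abs hi fun x => ?_)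
  simp only [abs_mul]
  exact mul_le_mul_of_nonneg_right (habs x) (abs_nonneg _)

theorem chiSq_tensorPow_le {v w : ℝ → ℝ} (hv : IsOUDensity v) (hw : IsOUDensity w)
    (hw0 : ∀ x, 0 < w x) (hi : Integrable (fun x => (w x - v x) ^ 2 / w x) ouMeasure) {n : ℕ}
    {e : ℝ} (he : ∫ x, (w x - v x) ^ 2 / w x ∂ouMeasure ≤ e) (hn : n * e ≤ 1) :
    Integrable (fun x => |tensorPow n w x - tensorPow n v x| ^ 2 / tensorPow n w x)
        (ouMeasurePi n) ∧
      ∫ x, |tensorPow n w x - tensorPow n v x| ^ 2 / tensorPow n w x ∂(ouMeasurePi n)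
        ≤ 2 * (n * e) := by
  obtain ⟨h1, h2⟩ := integral_sq_tensorPow_sub_div hv hw hw0 hi n
  have he0 : 0 ≤ ∫ x, (w x - v x) ^ 2 / w x ∂ouMeasure :=
    integral_nonneg fun x => div_nonneg (sq_nonneg _) (hw0 x).le
  have h3 := mul_le_mul_of_nonneg_left he n.cast_nonneg
  refine ⟨h1, ?_⟩
  rw [h2]
  linarith [one_add_pow_sub_one_le he0 (h3.trans hn)]

theorem proposition2p1 :
    ∃ lam₀ : ℝ, 0 < lam₀ ∧ ∀ (k : ℕ) (lam : ℝ), 1 ≤ k → 0 < lam → lam < lam₀ →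
    ∃ c : ℝ, 0 < c ∧
    ∀ (θ : ℝ → ℝ) (C₁ C₂ δ κ : ℝ), IsSmoothCutoff θ → 0 < δ → 0 < κ → κ < 1 →
    ∃ (C : ℝ) (N₀ : ℕ), 0 < C ∧ 1 ≤ N₀ ∧
    ∀ V : ℝ → ℝ, PotentialCond k C₁ C₂ δ V →
    ∀ (N : ℕ) (R t a : ℝ), N₀ ≤ N →
      R = (N : ℝ) ^ (lam / (4 * (k : ℝ))) → t = (N : ℝ) ^ (-1 + lam) → |a| ≤ κ * R →
      (∃! d : ℝ, IsOUDensity (cutoffDensity V θ R a d)) ∧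
      ∀ d : ℝ, IsOUDensity (cutoffDensity V θ R a d) →
        -- the expectation
        (Integrable (fun x => x * cutoffDensity V θ R a d x) ouMeasure ∧
          |∫ x, x * cutoffDensity V θ R a d x ∂ouMeasure|
            ≤ C * Real.exp (-c * (N : ℝ) ^ c)) ∧
        -- part (i)
        (Integrable (fun x => |tensorPow (N ^ 2) (cutoffDensity V θ R a d) x
              - tensorPow (N ^ 2) (fun y => Real.exp (-V y)) x|) (ouMeasurePi (N ^ 2)) ∧
          ∫ x, |tensorPow (N ^ 2) (cutoffDensity V θ R a d) x
              - tensorPow (N ^ 2) (fun y => Real.exp (-V y)) x| ∂(ouMeasurePi (N ^ 2))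
            ≤ C * Real.exp (-c * (N : ℝ) ^ c)) ∧
        -- part (ii)
        IsOUDensity (backwardDensity t (cutoffDensity V θ R a d)) ∧
        (∀ x, 0 < ouSemigroup t
          (tensorPow (N ^ 2) (backwardDensity t (cutoffDensity V θ R a d))) x) ∧
        Integrable (fun x =>
          |ouSemigroup t (tensorPow (N ^ 2) (backwardDensity t (cutoffDensity V θ R a d))) x
            - tensorPow (N ^ 2) (cutoffDensity V θ R a d) x| ^ 2
          / ouSemigroup t (tensorPow (N ^ 2) (backwardDensity t (cutoffDensity V θ R a d))) x)
          (ouMeasurePi (N ^ 2)) ∧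
        ∫ x,
          |ouSemigroup t (tensorPow (N ^ 2) (backwardDensity t (cutoffDensity V θ R a d))) x
            - tensorPow (N ^ 2) (cutoffDensity V θ R a d) x| ^ 2
          / ouSemigroup t (tensorPow (N ^ 2) (backwardDensity t (cutoffDensity V θ R a d))) x
          ∂(ouMeasurePi (N ^ 2))
            ≤ C * (N : ℝ) ^ 2 * t ^ (6 - lam) ∧
        C * (N : ℝ) ^ 2 * t ^ (6 - lam) ≤ C * (N : ℝ) ^ (-4 + 8 * lam) := by
  -- The value 1/4 makes both exponents -1+3λ and -4+6λ negative.
  refine ⟨1 / 4, by norm_num, fun k lam hk hlam hlam4 => ?_⟩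
  have hk0 : (0 : ℝ) < k := by exact_mod_cast hk
  have hc0 : 0 < lam / (4 * (k : ℝ)) := by positivity
  -- With this c, N^c is exactly the cutoff radius R.
  refine ⟨lam / (4 * (k : ℝ)), hc0, fun θ C₁ C₂ δ κ hθ hδ hκ0 hκ => ?_⟩
  obtain ⟨T, η, K, hT, hη, hK, hone⟩ := exists_oneDim_bounds hk hθ C₁ C₂ hδ hκ
  -- The three requirements are tR^{8k}K ≤ 1, N²t⁶K ≤ 1, and the tail bound. The latter is taken
  -- with 2T so that it also yields Te^{-ηR²} ≤ 1/2.
  obtain ⟨N₀, hN₀⟩ := Filter.eventually_atTop.1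
    ((eventually_rpow_mul_le_one (p := -1 + 3 * lam) (by linarith) K).and
      ((eventually_rpow_mul_le_one (p := -4 + 6 * lam) (by linarith) K).and
        (eventually_sq_mul_exp_le hc0 hη (2 * T))))
  refine ⟨1 + 2 * K, max N₀ 1, by positivity, le_max_right _ _, ?_⟩
  intro V hV N R t a hN hR ht ha
  obtain ⟨hN1, hN2, hN3⟩ := hN₀ N ((le_max_left _ _).trans hN)
  have hNone : (1 : ℝ) ≤ N := by exact_mod_cast (le_max_right _ _).trans hN
  have hNpos : (0 : ℝ) < N := by linarith
  have hRone : 1 ≤ R := by rw [hR]; exact Real.one_le_rpow hNone hc0.le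
  have ht0 : 0 < t := by rw [ht]; positivity
  have ht1 : t ≤ 1 := by rw [ht]; exact Real.rpow_le_one_of_one_le_of_nonpos hNone (by linarith)
  have htR : t * R ^ (8 * k) = (N : ℝ) ^ (-1 + 3 * lam) := by
    rw [ht, hR, ← Real.rpow_mul_natCast hNpos.le, ← Real.rpow_add hNpos]
    congr 1
    push_cast
    field_simp
    ring
  have ht6 : (N : ℝ) ^ 2 * t ^ 6 = (N : ℝ) ^ (-4 + 6 * lam) := by
    rw [ht, ← Real.rpow_mul_natCast hNpos.le, ← Real.rpow_two, ← Real.rpow_add hNpos]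
    congr 1
    push_cast
    ring
  rw [← hR] at hN3 ⊢
  generalize lam / (4 * (k : ℝ)) = c at *
  have hN2one : 1 ≤ (N : ℝ) ^ 2 := one_le_pow₀ hNone
  have htail0 : 0 ≤ T * Real.exp (-η * R ^ 2) := by positivity
  have hε1 : Real.exp (-c * R) ≤ 1 := Real.exp_le_one_iff.2 (by nlinarith)
  have htailN : (N : ℝ) ^ 2 * (T * Real.exp (-η * R ^ 2)) ≤ Real.exp (-c * R) := by
    refine le_trans ?_ hN3
    rw [mul_assoc 2 T]
    exact mul_le_mul_of_nonneg_left (by linarith) (by positivity)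
  have htail : 2 * (T * Real.exp (-η * R ^ 2)) ≤ Real.exp (-c * R) := by
    rw [← mul_assoc]
    refine le_trans (le_mul_of_one_le_left ?_ hN2one) hN3
    rw [mul_assoc]; positivity
  have hεC : Real.exp (-c * R) ≤ (1 + 2 * K) * Real.exp (-c * R) :=
    le_mul_of_one_le_left (Real.exp_pos _).le (by linarith)
  obtain ⟨huniq, hall⟩ := hone V R a hV hRone ha (by linarith)
  refine ⟨huniq, fun d hd => ?_⟩
  generalize hv : cutoffDensity V θ R a d = v at hd ⊢
  obtain ⟨hvc, iw, bw, hev⟩ := hall d v hv.symm hd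
  obtain ⟨hgd, hwpos, hwd, hchii, hchib⟩ := hev t ht0 (by rw [htR]; exact hN1)
  have hsemi : ouSemigroup t (tensorPow (N ^ 2) (backwardDensity t v))
      = tensorPow (N ^ 2) (ouSemigroupOne t (backwardDensity t v)) :=
    funext fun x => ouSemigroup_tensorPow _ _ _ _
  rw [hsemi]
  obtain ⟨hx, hxb⟩ := abs_integral_id_mul_le hV hvc iw
  obtain ⟨hl1i, hl1b⟩ := integral_abs_tensorPow_sub_le hV.density hd (N ^ 2)
  have hcast : ((N ^ 2 : ℕ) : ℝ) * (K * t ^ 6) = (N : ℝ) ^ 2 * t ^ 6 * K := by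
    push_cast; ring
  obtain ⟨htensi, htensb⟩ := chiSq_tensorPow_le hd hwd hwpos hchii hchib (n := N ^ 2)
    (by rw [hcast, ht6]; exact hN2)
  refine ⟨⟨hx, ?_⟩, ⟨hl1i, ?_⟩, hgd, fun x => Finset.prod_pos fun i _ => hwpos _, htensi, ?_, ?_⟩
  · linarith
  · refine hl1b.trans (le_trans (le_trans ?_ htailN) hεC)
    push_cast
    refine mul_le_mul_of_nonneg_left (le_trans ?_ bw) (by positivity)
    refine integral_mono (hd.2.1.sub hV.integrable_exp_neg).abs iw fun x => ?_
    exact le_mul_of_one_le_left (abs_nonneg _) (by nlinarith)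
  · have ht6lam : t ^ 6 ≤ t ^ (6 - lam) := by
      rw [← Real.rpow_natCast]
      exact Real.rpow_le_rpow_of_exponent_ge ht0 ht1 (by push_cast; linarith)
    refine htensb.trans ?_
    rw [hcast]
    calc 2 * ((N : ℝ) ^ 2 * t ^ 6 * K) = 2 * K * (N : ℝ) ^ 2 * t ^ 6 := by ring
      _ ≤ (1 + 2 * K) * (N : ℝ) ^ 2 * t ^ (6 - lam) := by gcongr; linarith
  · rw [mul_assoc]
    refine mul_le_mul_of_nonneg_left ?_ (by positivity)
    rw [ht, ← Real.rpow_mul hNpos.le, ← Real.rpow_two, ← Real.rpow_add hNpos]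
    -- The exponent is 2 + (-1+λ)(6-λ) = -4 + 7λ - λ² ≤ -4 + 8λ.
    exact Real.rpow_le_rpow_of_exponent_le hNone (by nlinarith)
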